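/- For $a>-1$ let $L^r_a$ ($1\le r<\infty$) be the Lebesgue space on $\mathbb R^+=(0,\infty)$ with respect to $d\omega_a(x)=x^a\,dx$, so that $\|f\|_{L^r_a}=\big(\int_0^\infty |f(x)|^r x^a\,dx\big)^{1/r}$. Let $\mathscr S^+$ be the space of all $\varphi\in C^\infty(\mathbb R^+;\mathbb C)$ such that $\sup_{x>0}\big|x^m\big(\tfrac1x\partial_x\big)^k\varphi(x)\big|<\infty$ for all $m,k\in\mathbb N_0$. For $x,y>0$ and $t\ne 0$ put $$S_a(x,y,t)=\frac{e^{\mp i\frac{(a+1)\pi}{4}}}{(2|t|)^{\frac{a+1}{2}}}\Big(\frac{xy}{2|t|}\Big)^{\frac{1-a}{2}}J_{\frac{a-1}{2}}\Big(\frac{xy}{2|t|}\Big)e^{\pm i\frac{x^2+y^2}{4|t|}},$$ with the upper signs for $t>0$ and the lower signs for $t<0$, where $J_\nu$ is the Bessel function of the first kind of order $\nu$, and for $\varphi\in\mathscr S^+$ let $$S_a(t)\varphi(x)=\int_0^\infty S_a(x,y,t)\varphi(y)\,d\omega_a(y),\qquad x>0.$$ Let $2\le r<\infty$ and $\frac1r+\frac1{r'}=1$.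 (i) For every $a\ge 0$ there exists a constant $C=C(a,r)>0$ such that, for every $\varphi\in\mathscr S^+$ and every $t\in\mathbb R\setminus\{0\}$, the integral defining $S_a(t)\varphi(x)$ converges absolutely for every $x>0$, $S_a(t)\varphi\in L^r_a$, and $$\|S_a(t)\varphi\|_{L^r_a}\le C\,|t|^{-(a+1)\left(\frac12-\frac1r\right)}\|\varphi\|_{L^{r'}_a}.$$ (ii) For every $-1<a<0$ there exists a constant $C=C(a,r)>0$ such that, with $k_1(x)=\min\{1,x^{a/2}\}$, for every $\varphi\in\mathscr S^+$ and every $t\in\mathbb R\setminus\{0\}$, the integral defining $S_a(t)\varphi(x)$ converges absolutely for every $x>0$, $S_a(t)\varphi\,k_1^{1-\frac2r}\in L^r_a$, and $$\big\|S_a(t)\varphi\,k_1^{1-\frac2r}\big\|_{L^r_a}\le C\Big\{|t|^{-(a+1)\left(\frac12-\frac1r\right)}+|t|^{-\left(\frac12-\frac1r\right)}\Big\}\big\|\varphi\,k_1^{1-\frac2{r'}}\big\|_{L^{r'}_a}.$$ -/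

import Mathlib

open MeasureTheory Set
open scoped ENNReal ContDiff

noncomputable section

namespace BesselSchrodinger

/-- The Bessel function of the first kind `J_ν(z)`, for real order `ν` and `z > 0`:
`∑ₖ (-1)^k / (Γ(k+1) Γ(ν+k+1)) (z/2)^(2k+ν)`. -/
def besselJ (ν z : ℝ) : ℝ :=
  ∑' k : ℕ, (-1 : ℝ) ^ k / (Real.Gamma (k + 1) * Real.Gamma (ν + k + 1)) *
    (z / 2) ^ (2 * (k : ℝ) + ν)

/-- The measure `dω_a(x) = x^a dx` on the half-line `(0, ∞)`, as a measure on `ℝ` carried by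
`(0, ∞)`. -/
def omega (a : ℝ) : Measure ℝ :=
  (volume.restrict (Ioi (0 : ℝ))).withDensity fun x => ENNReal.ofReal (x ^ a)

/-- The operator `f ↦ (1/x) ∂ₓ f`. -/
def invXDeriv (f : ℝ → ℂ) : ℝ → ℂ := fun x => (1 / (x : ℂ)) * deriv f x

/-- The space `𝒮⁺` of smooth functions `φ` on `(0, ∞)` with
`sup_{x > 0} |x^m ((1/x) ∂ₓ)^k φ(x)| < ∞` for all `m, k ∈ ℕ₀`. Functions on `(0, ∞)` are
represented by functions on `ℝ`, whose values on `(-∞, 0]` play no role. -/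
structure SchwartzPlus (φ : ℝ → ℂ) : Prop where
  smooth : ContDiffOn ℝ ∞ φ (Ioi 0)
  bounded : ∀ m k : ℕ, ∃ M : ℝ, ∀ x : ℝ, 0 < x → ‖(x : ℂ) ^ m * (invXDeriv^[k] φ) x‖ ≤ M

/-- The kernel `S_a(x, y, t)`, for `x, y > 0` and `t ≠ 0` (the value at `t = 0` is immaterial). -/
def kernel (a x y t : ℝ) : ℂ :=
  if t < 0 then
    Complex.exp (Complex.I * (((a + 1) * Real.pi / 4 : ℝ) : ℂ)) /
        (((2 * |t|) ^ ((a + 1) / 2) : ℝ) : ℂ) *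
      (((x * y / (2 * |t|)) ^ ((1 - a) / 2) * besselJ ((a - 1) / 2) (x * y / (2 * |t|)) : ℝ) : ℂ) *
      Complex.exp (-Complex.I * (((x ^ 2 + y ^ 2) / (4 * |t|) : ℝ) : ℂ))
  else
    Complex.exp (-Complex.I * (((a + 1) * Real.pi / 4 : ℝ) : ℂ)) /
        (((2 * |t|) ^ ((a + 1) / 2) : ℝ) : ℂ) *
      (((x * y / (2 * |t|)) ^ ((1 - a) / 2) * besselJ ((a - 1) / 2) (x * y / (2 * |t|)) : ℝ) : ℂ) *
      Complex.exp (Complex.I * (((x ^ 2 + y ^ 2) / (4 * |t|) : ℝ) : ℂ))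

/-- `S_a(t)φ(x) = ∫₀^∞ S_a(x, y, t) φ(y) dω_a(y)`. -/
def propagator (a t : ℝ) (φ : ℝ → ℂ) : ℝ → ℂ :=
  fun x => ∫ y, kernel a x y t * φ y ∂(omega a)

/-- The weight `k₁(x) = min {1, x^(a/2)}`. -/
def k₁ (a x : ℝ) : ℝ := min 1 (x ^ (a / 2))

/-- Multiplication of `f` by the power `k₁^s` of the weight. -/
def weighted (a s : ℝ) (f : ℝ → ℂ) : ℝ → ℂ := fun x => f x * ((k₁ a x ^ s : ℝ) : ℂ)

/-- The norm of `L^r_a`, with values in `[0, ∞]`, for `1 ≤ r < ∞`. -/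
def normLa (a r : ℝ) (f : ℝ → ℂ) : ℝ≥0∞ := eLpNorm f (ENNReal.ofReal r) (omega a)

/-- Membership in `L^r_a`, for `1 ≤ r < ∞`. -/
def MemLa (a r : ℝ) (f : ℝ → ℂ) : Prop := MemLp f (ENNReal.ofReal r) (omega a)

end BesselSchrodinger

end

/-! Put b = (a+1)/2 and τ = 2|t|. The kernel is a dilated Hankel kernel K(x, y) multiplied by a
unimodular function of x and a unimodular function of y (`exists_kernel_eq`), so every norm estimate
concerns the Hankel transform alone. Two endpoint bounds are needed: contraction of L², and L¹ → L^∞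
with constant the supremum B of the kernel, or of κ(x) |K(x, y)| κ(y) when a weight κ is present.
Interpolating between them produces B^(1 - 2/r).

Supremum bound. The function z^(1-b) J_(b-1)(z) is a multiple of `hyp b (-(z/2)^2)`, where `hyp b`
is entire and solves a second-order equation. An energy argument shows that it is bounded when b ≥
1/2, i.e. a ≥ 0 (`abs_hyp_neg_le`), and that it grows at most like z^(-a/2) when a < 0
(`exists_abs_hyp_neg_le`). This growth splits into a factor in x and a factor in y. The weight k₁
absorbs both, at the price of the second power of |t|.

L² bound. With a Gaussian weight exp(-εx²) inserted, Weber's second exponential integral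
(`integral_weber`) computes the TT* kernel: it is the heat kernel of the Bessel operator, which is
nonnegative, symmetric and of total mass 1. Schur's test bounds the weighted norm uniformly in ε,
and Fatou's lemma removes the weight (`lintegral_hankel_sq_le`).

Interpolation. The operator κKκ is considered on the measure κ⁻² dω, where the L² bound is unchanged
and the L¹ → L^∞ norm is at most B. A Marcinkiewicz-type level set argument
(`lintegral_rpow_le_of_interpolation`) covers r > 2. Its constant blows up at r = 2, where the L²
contraction is used directly. -/

noncomputable section

namespace BesselSchrodinger

open Real Filter Topology

section Series

open scoped Nat

/-! ### The entire function `hyp`: series, derivative, recurrence -/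

/-- The regularized confluent hypergeometric limit function
`∑ₖ w^k / (k! Γ(b + k))`. -/
def hyp (b w : ℝ) : ℝ := ∑' k : ℕ, w ^ k / (k ! * Gamma (b + k))

lemma Gamma_add_nat_pos {b : ℝ} (hb : 0 < b) (k : ℕ) : 0 < Gamma (b + k) :=
  Gamma_pos_of_pos (by positivity)

/-- `Gamma` is increasing on [2, ∞), so only k = 0 and k = 1 can give a value below 1. A uniform
lower bound lets the exponential series dominate `hyp`. -/
lemma exists_le_Gamma_add_nat {b : ℝ} (hb : 0 < b) :
    ∃ c, 0 < c ∧ ∀ k : ℕ, c ≤ Gamma (b + k) := by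
  refine ⟨min (Gamma b) (min (Gamma (b + 1)) 1), ?_, ?_⟩
  · exact lt_min (Gamma_pos_of_pos hb) (lt_min (Gamma_pos_of_pos (by linarith)) one_pos)
  · rintro (_ | _ | k)
    · simp
    · simp
    · refine (min_le_right _ _).trans ((min_le_right _ _).trans ?_)
      rw [← Gamma_two]
      refine Gamma_strictMonoOn_Ici.monotoneOn (by simp) ?_ ?_ <;> simp <;>
        linarith [(Nat.cast_nonneg k : (0 : ℝ) ≤ k)]

lemma summable_norm_hyp {b : ℝ} (hb : 0 < b) (w : ℝ) :
    Summable fun k : ℕ => ‖w ^ k / (k ! * Gamma (b + k))‖ := by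
  obtain ⟨c, hc, h⟩ := exists_le_Gamma_add_nat hb
  refine Summable.of_nonneg_of_le (fun _ => norm_nonneg _) (fun k => ?_)
    ((Real.summable_pow_div_factorial |w|).mul_right c⁻¹)
  have hG := Gamma_add_nat_pos hb k
  rw [norm_div, norm_pow, norm_mul, Real.norm_of_nonneg hG.le, Real.norm_eq_abs,
    Real.norm_of_nonneg (by positivity : (0 : ℝ) ≤ k !), ← div_div, div_eq_mul_inv]
  gcongr
  exact h k

lemma summable_hyp {b : ℝ} (hb : 0 < b) (w : ℝ) :
    Summable fun k : ℕ => w ^ k / (k ! * Gamma (b + k)) := (summable_norm_hyp hb w).of_norm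

lemma hyp_nonneg {b w : ℝ} (hb : 0 < b) (hw : 0 ≤ w) : 0 ≤ hyp b w :=
  tsum_nonneg fun k => by have := Gamma_add_nat_pos hb k; positivity

lemma hyp_zero {b : ℝ} : hyp b 0 = (Gamma b)⁻¹ := by
  rw [hyp, tsum_eq_single 0 (fun k hk => by simp [hk])]
  simp

/-- The index shift behind termwise differentiation: a factor k lowers the factorial and raises the
parameter b by one. -/
lemma succ_mul_div_factorial {b : ℝ} (k : ℕ) (x : ℝ) :
    ((k + 1 : ℕ) : ℝ) * x / ((k + 1)! * Gamma (b + (k + 1 : ℕ))) =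
      x / (k ! * Gamma (b + 1 + k)) := by
  have h1 : ((k + 1 : ℕ) : ℝ) ≠ 0 := by positivity
  rw [Nat.factorial_succ, Nat.cast_mul, mul_assoc, mul_div_mul_left _ _ h1]
  push_cast
  ring_nf

lemma hasDerivAt_hyp {b : ℝ} (hb : 0 < b) (w : ℝ) : HasDerivAt (hyp b) (hyp (b + 1) w) w := by
  set R := |w| + 1
  have hR : 0 ≤ R := by positivity
  have hsum : Summable fun k : ℕ => (k : ℝ) * R ^ (k - 1) / (k ! * Gamma (b + k)) := by
    rw [← summable_nat_add_iff 1]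
    simp only [succ_mul_div_factorial, Nat.add_sub_cancel]
    exact summable_hyp (by linarith) R
  have key := hasDerivAt_tsum_of_isPreconnected (𝕜 := ℝ) (F := ℝ)
    (g := fun (k : ℕ) (w : ℝ) => w ^ k / (k ! * Gamma (b + k)))
    (g' := fun (k : ℕ) (w : ℝ) => (k : ℝ) * w ^ (k - 1) / (k ! * Gamma (b + k)))
    (t := Metric.ball 0 R) (y₀ := 0) (y := w) hsum Metric.isOpen_ball
    (convex_ball _ _).isPreconnected (fun k y _ => (hasDerivAt_pow k y).div_const _)
    (fun k y hy => ?_) (by simp [R]; positivity) (summable_hyp hb 0) (by simp [R])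
  · have hw : Summable fun k : ℕ => (k : ℝ) * w ^ (k - 1) / (k ! * Gamma (b + k)) := by
      rw [← summable_nat_add_iff 1]
      simp only [succ_mul_div_factorial, Nat.add_sub_cancel]
      exact summable_hyp (by linarith) w
    refine key.congr_deriv ?_
    rw [hw.tsum_eq_zero_add]
    simp only [succ_mul_div_factorial, Nat.add_sub_cancel]
    simp [hyp]
  · have hG := Gamma_add_nat_pos hb k
    have hy' : |y| ≤ R := (mem_ball_zero_iff.1 hy).le
    rw [norm_div, norm_mul, norm_mul, norm_pow, Real.norm_of_nonneg hG.le, Real.norm_eq_abs y,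
      Real.norm_of_nonneg (by positivity : (0 : ℝ) ≤ k !),
      Real.norm_of_nonneg (by positivity : (0 : ℝ) ≤ k)]
    gcongr

lemma continuous_hyp {b : ℝ} (hb : 0 < b) : Continuous (hyp b) :=
  continuous_iff_continuousAt.2 fun w => (hasDerivAt_hyp hb w).continuousAt

/-- Termwise, k + b cancels the extra factor in Γ(b+1+k) = (b+k) Γ(b+k). Since differentiation
raises b by one, this is Bessel's differential equation in disguise. -/
lemma hyp_recurrence {b : ℝ} (hb : 0 < b) (w : ℝ) :
    w * hyp (b + 2) w + b * hyp (b + 1) w = hyp b w := by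
  have h1 := (summable_hyp (by linarith : 0 < b + 1) w).hasSum.mul_left b
  have h2 : HasSum (fun k : ℕ => (k : ℝ) * w ^ k / (k ! * Gamma (b + 1 + k)))
      (w * hyp (b + 2) w) := by
    rw [← hasSum_nat_add_iff' 1]
    simp only [succ_mul_div_factorial]
    convert! (summable_hyp (by linarith : 0 < b + 2) w).hasSum.mul_left w using 1
    · ext k; rw [show b + 1 + 1 = b + 2 by ring, pow_succ]; ring
    · simp [hyp]
  have h3 := h2.add h1
  rw [show (∑' k : ℕ, w ^ k / (k ! * Gamma (b + 1 + k))) = hyp (b + 1) w from rfl] at h3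
  rw [← h3.tsum_eq, hyp]
  refine tsum_congr fun k => ?_
  have hG := (Gamma_add_nat_pos hb k).ne'
  have hk : b + k ≠ 0 := by positivity
  rw [show b + 1 + (k : ℝ) = b + k + 1 by ring, Gamma_add_one hk]
  field_simp
  ring

/-! ### Growth of `hyp` on the negative half-line -/

lemma hasDerivAt_hyp_neg {b : ℝ} (hb : 0 < b) (s : ℝ) :
    HasDerivAt (fun s => hyp b (-s)) (-hyp (b + 1) (-s)) s := by
  exact ((hasDerivAt_hyp hb (-s)).comp s (hasDerivAt_neg s)).congr_deriv (by ring)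

/-- For `b ≥ 1/2` the energy `hyp b (-s) ^ 2 + s * hyp (b+1) (-s) ^ 2` is nonincreasing. -/
lemma abs_hyp_neg_le {b s : ℝ} (hb : 1 / 2 ≤ b) (hs : 0 ≤ s) :
    |hyp b (-s)| ≤ (Gamma b)⁻¹ := by
  have hb0 : 0 < b := by linarith
  have hE : ∀ s : ℝ, HasDerivAt (fun s => hyp b (-s) ^ 2 + s * hyp (b + 1) (-s) ^ 2)
      ((1 - 2 * b) * hyp (b + 1) (-s) ^ 2) s := by
    intro s
    have hr := hyp_recurrence hb0 (-s)
    have h := ((hasDerivAt_hyp_neg hb0 s).pow 2).add ((hasDerivAt_id s).mul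
      ((hasDerivAt_hyp_neg (by linarith : 0 < b + 1) s).pow 2))
    rw [show b + 1 + 1 = b + 2 by ring] at h
    refine h.congr_deriv ?_
    simp only [id, Pi.pow_apply]
    rw [← hr]
    push_cast
    ring
  have hanti : Antitone (fun s => hyp b (-s) ^ 2 + s * hyp (b + 1) (-s) ^ 2) := by
    refine antitone_of_deriv_nonpos (fun s => (hE s).differentiableAt) fun s => ?_
    rw [(hE s).deriv]
    exact mul_nonpos_of_nonpos_of_nonneg (by linarith) (sq_nonneg _)
  have h := hanti hs
  simp only [neg_zero, zero_mul, add_zero, hyp_zero] at h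
  have hG : 0 < (Gamma b)⁻¹ := inv_pos.2 (Gamma_pos_of_pos hb0)
  refine abs_le_of_sq_le_sq ?_ hG.le
  have : 0 ≤ s * hyp (b + 1) (-s) ^ 2 := by positivity
  linarith

/-- For `0 < b < 1/2` the energy corrected by a multiple of `hyp b (-s) * hyp (b+1) (-s)` grows at
most like `s ^ (1/2 - b)`. -/
lemma exists_sq_hyp_neg_le {b : ℝ} (hb : 0 < b) (hb' : b < 1 / 2) :
    ∃ C, 0 < C ∧ ∀ s, 1 ≤ s → hyp b (-s) ^ 2 ≤ C * s ^ (1 / 2 - b) := by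
  set G : ℝ → ℝ := fun s => hyp b (-s) with hGdef
  set H : ℝ → ℝ := fun s => hyp (b + 1) (-s) with hHdef
  set γ : ℝ := 1 - 2 * b with hγ
  have hγ0 : 0 < γ := by linarith
  have hγ1 : γ < 1 := by linarith
  -- The plain energy G² + sH² has derivative γH², which by itself only yields growth s^γ. Since
  -- (GH)' = (G² - sH²)/s - bGH/s, adding γ/2 times GH shares the growth evenly between G² and sH²,
  -- and E' = γ/(2s) (E - GH/2) has the sharp rate s^(γ/2).
  set E : ℝ → ℝ := fun s => G s ^ 2 + s * H s ^ 2 + γ / 2 * (G s * H s) with hEdef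
  have hH : ∀ s, 0 < s → HasDerivAt H ((G s - b * H s) / (-s) * -1) s := by
    intro s hs
    have h := hasDerivAt_hyp_neg (by linarith : 0 < b + 1) s
    refine h.congr_deriv ?_
    have hr := hyp_recurrence hb (-s)
    rw [show b + 1 + 1 = b + 2 by ring]
    simp only [G, H]
    rw [← hr]
    field_simp
    ring
  have hE : ∀ s, 0 < s → HasDerivAt E (γ / (2 * s) * (E s - 1 / 2 * (G s * H s))) s := by
    intro s hs
    have hG' : HasDerivAt G (-H s) s := hasDerivAt_hyp_neg hb s
    have h := ((hG'.pow 2).add ((hasDerivAt_id s).mul ((hH s hs).pow 2))).add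
      ((hG'.mul (hH s hs)).const_mul (γ / 2))
    refine h.congr_deriv ?_
    simp only [id, Pi.pow_apply, E, hγ]
    field_simp
    ring
  -- The cross term satisfies √s |GH| ≤ (G² + sH²)/2, so for s ≥ 1 and γ < 1 it costs at most a
  -- quarter of the plain energy: E ≥ 3/4 (G² + sH²). This is the source of 2/3 and 4/3.
  have hGH : ∀ s, 1 ≤ s → √s * |G s * H s| ≤ 2 / 3 * E s ∧ G s ^ 2 ≤ 4 / 3 * E s := by
    intro s hs
    have h1 : 1 ≤ √s := by simpa using hs
    have h2 : √s ^ 2 = s := sq_sqrt (by linarith)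
    have h3 : √s * |G s * H s| ≤ (G s ^ 2 + s * H s ^ 2) / 2 := by
      rw [abs_mul, ← sq_abs (G s), ← sq_abs (H s)]
      nlinarith [sq_nonneg (|G s| - √s * |H s|)]
    have h4 : |G s * H s| ≤ √s * |G s * H s| := le_mul_of_one_le_left (abs_nonneg _) h1
    have h5 : -|G s * H s| ≤ G s * H s := neg_abs_le _
    have h6 : γ / 2 * (-|G s * H s|) ≤ γ / 2 * (G s * H s) := by gcongr
    have h7 : γ / 2 * |G s * H s| ≤ 1 / 2 * |G s * H s| := by gcongr
    have h8 : 0 ≤ s * H s ^ 2 := by positivity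
    simp only [E]
    constructor <;> nlinarith
  have hE0 : ∀ s, 1 ≤ s → 0 ≤ E s := fun s hs => by
    have := (hGH s hs).2
    nlinarith [sq_nonneg (G s)]
  -- Integrating factor: s^(-γ/2) cancels the main term of E'/E, and exp(1/√s), which stays between
  -- 1 and e for s ≥ 1, absorbs the remaining error of order s^(-3/2).
  set F : ℝ → ℝ := fun s => E s * s ^ (-(γ / 2)) * exp ((√s)⁻¹) with hFdef
  have hF : ∀ s, 0 < s → HasDerivAt F ((γ / (2 * s) * (E s - 1 / 2 * (G s * H s)) * s ^ (-(γ / 2))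
      + E s * (-(γ / 2) * s ^ (-(γ / 2) - 1))) * exp ((√s)⁻¹)
      + E s * s ^ (-(γ / 2)) * (exp ((√s)⁻¹) * (-(1 / (2 * √s)) / (√s) ^ 2))) s := by
    intro s hs
    exact ((hE s hs).mul (hasDerivAt_rpow_const (Or.inl hs.ne'))).mul
      (((hasDerivAt_sqrt hs.ne').inv (sqrt_pos.2 hs).ne').exp)
  have hanti : AntitoneOn F (Ici 1) := by
    refine antitoneOn_of_deriv_nonpos (convex_Ici 1)
      (fun s hs => (hF s (by linarith [mem_Ici.1 hs])).continuousAt.continuousWithinAt)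
      (fun s hs => ?_) (fun s hs => ?_)
    · rw [interior_Ici] at hs
      exact (hF s (by linarith [mem_Ioi.1 hs])).differentiableAt.differentiableWithinAt
    · rw [interior_Ici, mem_Ioi] at hs
      have hs0 : 0 < s := by linarith
      rw [(hF s hs0).deriv]
      have hsq : 0 < √s := sqrt_pos.2 hs0
      have h2 : √s ^ 2 = s := sq_sqrt hs0.le
      have e : s ^ (-(γ / 2) - 1) = s ^ (-(γ / 2)) / s := by
        rw [rpow_sub_one hs0.ne']
      rw [e]
      have : (γ / (2 * s) * (E s - 1 / 2 * (G s * H s)) * s ^ (-(γ / 2))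
          + E s * (-(γ / 2) * (s ^ (-(γ / 2)) / s))) * exp ((√s)⁻¹)
          + E s * s ^ (-(γ / 2)) * (exp ((√s)⁻¹) * (-(1 / (2 * √s)) / (√s) ^ 2)) =
          -(s ^ (-(γ / 2)) * exp ((√s)⁻¹) / (2 * s * √s)) *
            (E s + γ / 2 * (√s * (G s * H s))) := by
        rw [h2]
        field_simp
        ring
      rw [this]
      refine mul_nonpos_of_nonpos_of_nonneg ?_ ?_
      · rw [neg_nonpos]; positivity
      · have h3 := (hGH s hs.le).1
        have h4 : -|G s * H s| ≤ G s * H s := neg_abs_le _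
        have h5 : γ / 2 * (√s * (-|G s * H s|)) ≤ γ / 2 * (√s * (G s * H s)) := by gcongr
        have h6 : γ / 2 * (√s * |G s * H s|) ≤ 1 / 2 * (√s * |G s * H s|) := by gcongr
        have := hE0 s hs.le
        nlinarith
  refine ⟨4 / 3 * F 1 + 1, ?_, fun s hs => ?_⟩
  · have : 0 ≤ F 1 := by have := hE0 1 le_rfl; positivity
    linarith
  · have h1 := hanti (mem_Ici.2 le_rfl) (mem_Ici.2 hs) hs
    have hs0 : 0 < s := by linarith
    have h2 : E s * s ^ (-(γ / 2)) ≤ F s := by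
      refine le_mul_of_one_le_right ?_ (one_le_exp (by positivity))
      have := hE0 s hs
      positivity
    have h3 : E s ≤ F 1 * s ^ (γ / 2) := by
      have h4 : E s * s ^ (-(γ / 2)) ≤ F 1 := h2.trans h1
      rw [rpow_neg hs0.le, ← div_eq_mul_inv, div_le_iff₀ (by positivity)] at h4
      exact h4
    have h5 := (hGH s hs).2
    rw [show 1 / 2 - b = γ / 2 by rw [hγ]; ring]
    have h6 : 0 < s ^ (γ / 2) := by positivity
    simp only [G] at h5
    nlinarith

lemma exists_abs_hyp_neg_le {b : ℝ} (hb : 0 < b) (hb' : b < 1 / 2) :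
    ∃ C, 0 < C ∧ ∀ s, 0 ≤ s → |hyp b (-s)| ≤ C * (1 + s ^ ((1 / 2 - b) / 2)) := by
  obtain ⟨C, hC, h⟩ := exists_sq_hyp_neg_le hb hb'
  obtain ⟨D, hD⟩ := (isCompact_Icc (a := (0 : ℝ)) (b := 1)).exists_bound_of_continuousOn
    ((continuous_hyp hb).comp continuous_neg).continuousOn
  have hD0 : 0 ≤ D := (norm_nonneg _).trans (hD 0 (by simp))
  refine ⟨D + √C, by positivity, fun s hs => ?_⟩
  have hp : 0 ≤ s ^ ((1 / 2 - b) / 2) := by positivity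
  have hCs : 0 ≤ √C := by positivity
  rcases le_total s 1 with h1 | h1
  · have := hD s ⟨hs, h1⟩
    simp only [Function.comp, Real.norm_eq_abs] at this
    nlinarith [mul_nonneg hD0 hp, mul_nonneg hCs hp]
  · have : |hyp b (-s)| ≤ √C * s ^ ((1 / 2 - b) / 2) := by
      refine abs_le_of_sq_le_sq ?_ (by positivity)
      rw [mul_pow, sq_sqrt hC.le, ← rpow_natCast (s ^ _), ← rpow_mul hs]
      rw [show (1 / 2 - b) / 2 * ((2 : ℕ) : ℝ) = 1 / 2 - b by push_cast; ring]
      exact h s h1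
    nlinarith [mul_nonneg hD0 hp]

/-! ### Weber's second exponential integral -/

/-- A form of the Chu–Vandermonde identity. -/
lemma sum_choose_div_Gamma (j k : ℕ) {b : ℝ} (hb : 0 < b) :
    ∑ m ∈ Finset.range (k + 1), (j.choose m : ℝ) / ((k - m)! * Gamma (b + m)) =
      Gamma (b + j + k) / (k ! * Gamma (b + j) * Gamma (b + k)) := by
  induction j generalizing k b with
  | zero =>
    rw [Finset.sum_eq_single 0]
    · have h1 := (Gamma_add_nat_pos hb k).ne'
      have h2 := (Gamma_pos_of_pos hb).ne'
      simp only [Nat.choose_self, Nat.cast_one, tsub_zero, Nat.cast_zero, add_zero]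
      field_simp
    · intro m _ hm
      simp [Nat.choose_eq_zero_of_lt (Nat.pos_of_ne_zero hm)]
    · simp
  | succ j ih =>
    have hj : b + j ≠ 0 := by positivity
    have hGj := (Gamma_add_nat_pos hb j).ne'
    have hGk := (Gamma_add_nat_pos hb k).ne'
    cases k with
    | zero =>
      have h2 := (Gamma_add_nat_pos hb (j + 1)).ne'
      have h3 := (Gamma_pos_of_pos hb).ne'
      simp only [zero_add, Finset.range_one, Finset.sum_singleton, Nat.choose_zero_right,
        Nat.cast_one, Nat.factorial_zero, Nat.cast_zero, add_zero, tsub_self]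
      field_simp
    | succ k =>
      have e1 := ih (k + 1) hb
      have e2 := ih k (by linarith : 0 < b + 1)
      -- Pascal's rule splits the sum into the case (j, k+1, b) and, after shifting m, the case (j,
      -- k, b+1). The induction is therefore over all k and b.
      have key : ∑ m ∈ Finset.range (k + 1 + 1),
          ((j + 1).choose m : ℝ) / ((k + 1 - m)! * Gamma (b + m)) =
          ∑ m ∈ Finset.range (k + 1 + 1), (j.choose m : ℝ) / ((k + 1 - m)! * Gamma (b + m)) +
          ∑ m ∈ Finset.range (k + 1), (j.choose m : ℝ) / ((k - m)! * Gamma (b + 1 + m)) := by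
        rw [Finset.sum_range_succ', Finset.sum_range_succ' _ (k + 1), add_right_comm,
          ← Finset.sum_add_distrib]
        congr 1
        · refine Finset.sum_congr rfl fun m _ => ?_
          rw [Nat.choose_succ_succ, Nat.add_sub_add_right,
            show b + 1 + (m : ℝ) = b + (m + 1 : ℕ) by push_cast; ring]
          push_cast
          ring
        · simp
      rw [key, e1, e2]
      have hjk : b + j + (k + 1 : ℕ) ≠ 0 := by positivity
      rw [show b + (j + 1 : ℕ) = b + j + 1 by push_cast; ring,
        show b + (j : ℝ) + 1 + (k + 1 : ℕ) = b + j + (k + 1 : ℕ) + 1 by push_cast; ring,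
        show b + 1 + (j : ℝ) = b + j + 1 by ring,
        show b + (j : ℝ) + 1 + (k : ℝ) = b + j + (k + 1 : ℕ) by push_cast; ring,
        show b + 1 + (k : ℝ) = b + (k + 1 : ℕ) by push_cast; ring,
        Gamma_add_one hj, Gamma_add_one hjk, Nat.factorial_succ]
      push_cast at hGk ⊢
      field_simp

lemma hasSum_prod_mul {ι κ : Type*} {f : ι → ℝ} {g : κ → ℝ} {s t : ℝ} (hf : HasSum f s)
    (hg : HasSum g t) : HasSum (fun x : ι × κ => f x.1 * g x.2) (s * t) := by
  have h := summable_mul_of_summable_norm hf.summable.norm hg.summable.norm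
  exact hf.mul hg h

lemma hasSum_hyp {b : ℝ} (hb : 0 < b) (w : ℝ) :
    HasSum (fun k : ℕ => w ^ k / (k ! * Gamma (b + k))) (hyp b w) := (summable_hyp hb w).hasSum

/-- The double series behind Weber's second exponential integral. -/
lemma hasSum_weber {b : ℝ} (hb : 0 < b) (u v : ℝ) :
    HasSum (fun jk : ℕ × ℕ => u ^ jk.1 * v ^ jk.2 * Gamma (b + jk.1 + jk.2) /
      (jk.1 ! * jk.2 ! * Gamma (b + jk.1) * Gamma (b + jk.2)))
      (exp u * exp v * hyp b (u * v)) := by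
  have hexp : ∀ u : ℝ, HasSum (fun p : ℕ => u ^ p / p !) (exp u) := fun u => by
    rw [Real.exp_eq_exp_ℝ]
    exact NormedSpace.expSeries_div_hasSum_exp u
  have h2 := hasSum_prod_mul (hexp u) (hexp v)
  have h3 := hasSum_prod_mul h2 (hasSum_hyp hb (u * v))
  -- The product of the three series has terms in u^(p+m) v^(q+m). The reindexing j = p+m, k = q+m
  -- makes m range over m ≤ min(j, k), and summing over m for fixed (j, k) is the Chu–Vandermonde
  -- sum.
  set F : (ℕ × ℕ) × ℕ → ℝ := fun x => if x.2 ≤ x.1.1 ∧ x.2 ≤ x.1.2 then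
    u ^ x.1.1 * v ^ x.1.2 / ((x.1.1 - x.2)! * (x.1.2 - x.2)! * x.2 ! * Gamma (b + x.2)) else 0
    with hF
  set ι : (ℕ × ℕ) × ℕ → (ℕ × ℕ) × ℕ := fun x => ((x.1.1 + x.2, x.1.2 + x.2), x.2) with hι
  have hinj : Function.Injective ι := by
    rintro ⟨⟨p, q⟩, m⟩ ⟨⟨p', q'⟩, m'⟩ h
    simp only [hι, Prod.mk.injEq] at h ⊢
    omega
  have hFsum : HasSum F (exp u * exp v * hyp b (u * v)) := by
    rw [← hinj.hasSum_iff]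
    · convert! h3 using 1
      ext ⟨⟨p, q⟩, m⟩
      have := (Gamma_add_nat_pos hb m).ne'
      simp only [hF, hι, Function.comp, le_add_iff_nonneg_left, zero_le, and_self, if_true,
        Nat.add_sub_cancel]
      field_simp
      ring
    · rintro ⟨⟨j, k⟩, m⟩ hx
      have h : ¬(m ≤ j ∧ m ≤ k) := fun h => hx ⟨((j - m, k - m), m), by
        simp only [hι, Nat.sub_add_cancel h.1, Nat.sub_add_cancel h.2]⟩
      simp only [hF, if_neg h]
  apply HasSum.prod_fiberwise hFsum
  rintro ⟨j, k⟩
  have hval : u ^ j * v ^ k * Gamma (b + j + k) / (j ! * k ! * Gamma (b + j) * Gamma (b + k)) =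
      ∑ m ∈ Finset.range (k + 1), F ((j, k), m) := by
    rw [show u ^ j * v ^ k * Gamma (b + j + k) / (j ! * k ! * Gamma (b + j) * Gamma (b + k)) =
      u ^ j * v ^ k / j ! * (Gamma (b + j + k) / (k ! * Gamma (b + j) * Gamma (b + k))) by
        have := (Gamma_add_nat_pos hb j).ne'
        have := (Gamma_add_nat_pos hb k).ne'
        field_simp, ← sum_choose_div_Gamma j k hb, Finset.mul_sum]
    refine Finset.sum_congr rfl fun m hm => ?_
    have hmk : m ≤ k := by simpa [Nat.lt_succ_iff] using hm
    have hG := (Gamma_add_nat_pos hb m).ne'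
    by_cases hmj : m ≤ j
    · simp only [hF, hmj, hmk, and_self, if_true]
      rw [← Nat.choose_mul_factorial_mul_factorial hmj]
      have : (j.choose m : ℝ) ≠ 0 := by exact_mod_cast (Nat.choose_pos hmj).ne'
      push_cast
      field_simp
    · simp [hF, hmj, Nat.choose_eq_zero_of_lt (not_le.1 hmj)]
  simp only
  rw [hval]
  refine hasSum_sum_of_ne_finset_zero fun m hm => ?_
  have h : ¬(m ≤ j ∧ m ≤ k) := fun h => hm (by simpa [Nat.lt_succ_iff] using h.2)
  simp only [hF, if_neg h]

lemma integral_gaussian_moment {c ε : ℝ} (hc : 0 < c) (hε : 0 < ε) :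
    ∫ x in Ioi (0 : ℝ), x ^ (2 * c - 1) * exp (-ε * x ^ 2) = 1 / 2 * (ε ^ (-c) * Gamma c) := by
  have h := integral_rpow_mul_exp_neg_mul_rpow (p := 2) (q := 2 * c - 1) two_pos (by linarith) hε
  simp only [rpow_two] at h
  rw [h, show -(2 * c - 1 + 1) / 2 = -c by ring, show (2 * c - 1 + 1) / 2 = c by ring]
  ring

lemma integrableOn_gaussian_moment {c ε : ℝ} (hc : 0 < c) (hε : 0 < ε) :
    IntegrableOn (fun x : ℝ => x ^ (2 * c - 1) * exp (-ε * x ^ 2)) (Ioi 0) :=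
  integrableOn_rpow_mul_exp_neg_mul_sq hε (by linarith)

/-- Weber's second exponential integral. -/
lemma integral_weber {b ε : ℝ} (hb : 0 < b) (hε : 0 < ε) (p q : ℝ) :
    ∫ x in Ioi (0 : ℝ), exp (-ε * x ^ 2) * (hyp b (-(p * x ^ 2)) * hyp b (-(q * x ^ 2))) *
      x ^ (2 * b - 1) =
      1 / 2 * ε ^ (-b) * (exp (-(p / ε)) * exp (-(q / ε)) * hyp b (p * q / ε ^ 2)) := by
  set c : ℕ × ℕ → ℝ := fun jk => (jk.1 ! * jk.2 ! * Gamma (b + jk.1) * Gamma (b + jk.2))⁻¹ with hc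
  have hc0 : ∀ jk, 0 < c jk := fun jk => by
    have := Gamma_add_nat_pos hb jk.1
    have := Gamma_add_nat_pos hb jk.2
    simp only [hc]; positivity
  set F : ℕ × ℕ → ℝ → ℝ := fun jk x => ((-p) ^ jk.1 * (-q) ^ jk.2 * c jk) *
    (x ^ (2 * (b + jk.1 + jk.2) - 1) * exp (-ε * x ^ 2)) with hF
  have hpos : ∀ jk : ℕ × ℕ, 0 < b + jk.1 + jk.2 := fun jk => by positivity
  have hε' : ∀ jk : ℕ × ℕ, ε ^ (-(b + jk.1 + jk.2)) = ε ^ (-b) * (ε⁻¹ ^ jk.1 * ε⁻¹ ^ jk.2) := by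
    intro jk
    rw [show -(b + jk.1 + jk.2) = -b + -(jk.1 : ℝ) + -(jk.2 : ℝ) by ring, rpow_add hε,
      rpow_add hε, rpow_neg hε.le (jk.1 : ℝ), rpow_neg hε.le (jk.2 : ℝ), rpow_natCast,
      rpow_natCast, inv_pow, inv_pow]
    ring
  have hintg : ∀ jk, IntegrableOn (F jk) (Ioi 0) := fun jk =>
    (integrableOn_gaussian_moment (hpos jk) hε).const_mul _
  have hval : ∀ jk, ∫ x in Ioi (0 : ℝ), F jk x = 1 / 2 * ε ^ (-b) *
      ((-(p / ε)) ^ jk.1 * (-(q / ε)) ^ jk.2 * Gamma (b + jk.1 + jk.2) /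
      (jk.1 ! * jk.2 ! * Gamma (b + jk.1) * Gamma (b + jk.2))) := by
    intro jk
    simp only [hF]
    rw [integral_const_mul, integral_gaussian_moment (hpos jk) hε, hε',
      show -(p / ε) = -p * ε⁻¹ by rw [neg_mul, div_eq_mul_inv],
      show -(q / ε) = -q * ε⁻¹ by rw [neg_mul, div_eq_mul_inv], mul_pow, mul_pow]
    simp only [hc]
    ring
  -- The absolute values integrate to the same double series at |p|/ε and |q|/ε, which is summable;
  -- this licenses integration term by term.
  have hnorm : ∀ jk, ∫ x in Ioi (0 : ℝ), ‖F jk x‖ = 1 / 2 * ε ^ (-b) *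
      ((|p| / ε) ^ jk.1 * (|q| / ε) ^ jk.2 * Gamma (b + jk.1 + jk.2) /
      (jk.1 ! * jk.2 ! * Gamma (b + jk.1) * Gamma (b + jk.2))) := by
    intro jk
    have : ∀ x ∈ Ioi (0 : ℝ), ‖F jk x‖ = (|p| ^ jk.1 * |q| ^ jk.2 * c jk) *
        (x ^ (2 * (b + jk.1 + jk.2) - 1) * exp (-ε * x ^ 2)) := by
      intro x hx
      have hx : 0 < x := hx
      simp only [hF, norm_mul, norm_pow, norm_neg, Real.norm_eq_abs, abs_of_pos (hc0 jk), abs_exp,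
        abs_of_pos (rpow_pos_of_pos hx _)]
    rw [setIntegral_congr_fun measurableSet_Ioi this, integral_const_mul,
      integral_gaussian_moment (hpos jk) hε, hε', div_eq_mul_inv |p|, div_eq_mul_inv |q|, mul_pow,
      mul_pow]
    simp only [hc]
    ring
  have hsum := hasSum_integral_of_summable_integral_norm (μ := volume.restrict (Ioi (0 : ℝ))) hintg
    (by simp only [hnorm]; exact ((hasSum_weber hb _ _).mul_left _).summable)
  simp only [hval] at hsum
  have hw := (hasSum_weber hb (-(p / ε)) (-(q / ε))).mul_left (1 / 2 * ε ^ (-b))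
  rw [show p * q / ε ^ 2 = -(p / ε) * -(q / ε) by field_simp, hw.unique hsum]
  apply setIntegral_congr_fun measurableSet_Ioi
  intro x hx
  have hx : 0 < x := hx
  have hmul := hasSum_prod_mul (hasSum_hyp hb (-(p * x ^ 2))) (hasSum_hyp hb (-(q * x ^ 2)))
  have := (hmul.mul_left (exp (-ε * x ^ 2))).mul_right (x ^ (2 * b - 1))
  simp only
  rw [← this.tsum_eq]
  refine tsum_congr fun jk => ?_
  simp only [hF, hc]
  rw [show 2 * (b + jk.1 + jk.2) - 1 = 2 * b - 1 + ((2 * jk.1 : ℕ) : ℝ) + ((2 * jk.2 : ℕ) : ℝ) by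
    push_cast; ring, rpow_add hx, rpow_add hx, rpow_natCast, rpow_natCast, pow_mul, pow_mul,
    ← neg_mul, ← neg_mul, mul_pow, mul_pow]
  have := (Gamma_add_nat_pos hb jk.1).ne'
  have := (Gamma_add_nat_pos hb jk.2).ne'
  field_simp

/-! ### Schur's test for the TT* kernel -/

/-- A weighted `L²` bound for an integral operator from Schur's test for the `TT*` kernel. -/
lemma lintegral_weight_mul_sq_le {α : Type*} [MeasurableSpace α] {μ : Measure α} [SFinite μ]
    {K G : α → α → ℝ} {ρ : α → ℝ} {h : α → ℂ} (hh : Measurable h) (hρ : ∀ x, 0 ≤ ρ x)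
    (hintg : Integrable (fun p : α × α × α => ((ρ p.1 * (K p.1 p.2.1 * K p.1 p.2.2) : ℝ) : ℂ) *
      (h p.2.1 * starRingEnd ℂ (h p.2.2))) (μ.prod (μ.prod μ)))
    (hG : ∀ y z, ∫ x, ρ x * (K x y * K x z) ∂μ = G y z) (hG0 : ∀ y z, 0 ≤ G y z)
    (hGm : Measurable fun p : α × α => G p.1 p.2)
    (hGsymm : ∀ y z, G y z = G z y) (hG1 : ∀ y, ∫⁻ z, ENNReal.ofReal (G y z) ∂μ ≤ 1) :
    ∫⁻ x, ENNReal.ofReal (ρ x) * ‖∫ y, (K x y : ℂ) * h y ∂μ‖ₑ ^ 2 ∂μ ≤ ∫⁻ x, ‖h x‖ₑ ^ 2 ∂μ := by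
  set N : α → ℂ := fun x => ∫ y, (K x y : ℂ) * h y ∂μ with hN
  set F : α → α × α → ℂ := fun x p => ((ρ x * (K x p.1 * K x p.2) : ℝ) : ℂ) *
      (h p.1 * starRingEnd ℂ (h p.2)) with hF
  -- Expanding |N|² as a double integral turns ∫ ρ|N|² into the quadratic form of G evaluated at h,
  -- once Fubini is applied.
  have hJ : ∀ x, ∫ p, F x p ∂(μ.prod μ) = ((ρ x * ‖N x‖ ^ 2 : ℝ) : ℂ) := by
    intro x
    have e1 : ∀ p, F x p = (ρ x : ℂ) *
        (((K x p.1 : ℂ) * h p.1) * starRingEnd ℂ ((K x p.2 : ℂ) * h p.2)) := by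
      intro p
      simp only [hF, map_mul, Complex.conj_ofReal]
      push_cast
      ring
    simp only [e1]
    rw [integral_const_mul, integral_prod_mul (fun y => (K x y : ℂ) * h y)
      (fun y => starRingEnd ℂ ((K x y : ℂ) * h y)), integral_conj, Complex.mul_conj']
    push_cast
    rfl
  have hintj : Integrable (fun x => ρ x * ‖N x‖ ^ 2) μ := by
    have := hintg.integral_prod_left
    have h2 := this.re
    refine h2.congr (ae_of_all _ fun x => ?_)
    have h3 := hJ x
    simp only [hF] at h3
    simp only [h3]
    exact Complex.ofReal_re _
  have e2 : ∀ x, ENNReal.ofReal (ρ x) * ‖N x‖ₑ ^ 2 = ENNReal.ofReal (ρ x * ‖N x‖ ^ 2) := by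
    intro x
    rw [ENNReal.ofReal_mul (hρ x), ENNReal.ofReal_pow (norm_nonneg _), ofReal_norm]
  have hswap : ∫ x, ∫ p, F x p ∂(μ.prod μ) ∂μ = ∫ p, ∫ x, F x p ∂μ ∂(μ.prod μ) :=
    integral_integral_swap hintg
  have hFx : ∀ p, ∫ x, F x p ∂μ = (G p.1 p.2 : ℂ) * (h p.1 * starRingEnd ℂ (h p.2)) := by
    intro p
    simp only [hF]
    rw [integral_mul_const, integral_complex_ofReal, hG]
  have e3 : ENNReal.ofReal (∫ x, ρ x * ‖N x‖ ^ 2 ∂μ) =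
      ‖∫ p : α × α, (G p.1 p.2 : ℂ) * (h p.1 * starRingEnd ℂ (h p.2)) ∂(μ.prod μ)‖ₑ := by
    simp only [← hFx]
    rw [← hswap]
    simp only [hJ]
    rw [integral_complex_ofReal, ← ofReal_norm, Complex.norm_real, Real.norm_of_nonneg]
    exact integral_nonneg fun x => mul_nonneg (hρ x) (sq_nonneg _)
  have hGm' : Measurable fun p : α × α => ENNReal.ofReal (G p.1 p.2) := hGm.ennreal_ofReal
  have hhm : Measurable fun x => ‖h x‖ₑ ^ 2 := hh.enorm.pow_const 2
  have mA : Measurable fun p : α × α => ENNReal.ofReal (G p.1 p.2) * ‖h p.1‖ₑ ^ 2 :=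
    hGm'.mul (hhm.comp measurable_fst)
  have mB : Measurable fun p : α × α => ENNReal.ofReal (G p.1 p.2) * ‖h p.2‖ₑ ^ 2 :=
    hGm'.mul (hhm.comp measurable_snd)
  have mG : ∀ y, Measurable fun z => ENNReal.ofReal (G y z) := fun y =>
    hGm'.comp measurable_prodMk_left
  have hA : ∫⁻ p : α × α, ENNReal.ofReal (G p.1 p.2) * ‖h p.1‖ₑ ^ 2 ∂(μ.prod μ) ≤
      ∫⁻ x, ‖h x‖ₑ ^ 2 ∂μ := by
    rw [lintegral_prod _ mA.aemeasurable]
    refine lintegral_mono fun y => ?_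
    simp only
    rw [lintegral_mul_const _ (mG y)]
    exact mul_le_of_le_one_left zero_le (hG1 y)
  have hB : ∫⁻ p : α × α, ENNReal.ofReal (G p.1 p.2) * ‖h p.2‖ₑ ^ 2 ∂(μ.prod μ) ≤
      ∫⁻ x, ‖h x‖ₑ ^ 2 ∂μ := by
    rw [lintegral_prod_symm _ mB.aemeasurable]
    refine lintegral_mono fun z => ?_
    simp only
    simp only [hGsymm _ z]
    rw [lintegral_mul_const _ (mG z)]
    exact mul_le_of_le_one_left zero_le (hG1 z)
  calc ∫⁻ x, ENNReal.ofReal (ρ x) * ‖N x‖ₑ ^ 2 ∂μ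
      = ENNReal.ofReal (∫ x, ρ x * ‖N x‖ ^ 2 ∂μ) := by
        simp only [e2]
        rw [ofReal_integral_eq_lintegral_ofReal hintj
          (ae_of_all _ fun x => mul_nonneg (hρ x) (sq_nonneg _))]
    _ ≤ ∫⁻ p : α × α, ‖(G p.1 p.2 : ℂ) * (h p.1 * starRingEnd ℂ (h p.2))‖ₑ ∂(μ.prod μ) := by
        rw [e3]; exact enorm_integral_le_lintegral_enorm _
    -- The elementary inequality 2|h(y) h(z)| ≤ |h(y)|² + |h(z)|²; each half is then controlled by
    -- the row integrals of the symmetric kernel G.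
    _ ≤ ∫⁻ p : α × α, (2⁻¹ * (ENNReal.ofReal (G p.1 p.2) * ‖h p.1‖ₑ ^ 2) +
          2⁻¹ * (ENNReal.ofReal (G p.1 p.2) * ‖h p.2‖ₑ ^ 2)) ∂(μ.prod μ) := by
        refine lintegral_mono fun p => ?_
        simp only
        have h2 : (2⁻¹ : ℝ≥0∞) = ENNReal.ofReal (1 / 2) := by
          rw [one_div, ENNReal.ofReal_inv_of_pos two_pos]; simp
        have := hG0 p.1 p.2
        rw [← ofReal_norm, ← ofReal_norm (h p.1), ← ofReal_norm (h p.2), h2,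
          ← ENNReal.ofReal_pow (norm_nonneg _), ← ENNReal.ofReal_pow (norm_nonneg _),
          ← ENNReal.ofReal_mul this, ← ENNReal.ofReal_mul this,
          ← ENNReal.ofReal_mul (by norm_num), ← ENNReal.ofReal_mul (by norm_num),
          ← ENNReal.ofReal_add (by positivity) (by positivity)]
        refine ENNReal.ofReal_le_ofReal ?_
        rw [norm_mul, norm_mul, RCLike.norm_conj, Complex.norm_real, Real.norm_of_nonneg this]
        nlinarith [mul_nonneg this (sq_nonneg (‖h p.1‖ - ‖h p.2‖))]
    _ ≤ 2⁻¹ * (∫⁻ x, ‖h x‖ₑ ^ 2 ∂μ) + 2⁻¹ * ∫⁻ x, ‖h x‖ₑ ^ 2 ∂μ := by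
        rw [lintegral_add_left (mA.const_mul _), lintegral_const_mul _ mA,
          lintegral_const_mul _ mB]
        gcongr
    _ = ∫⁻ x, ‖h x‖ₑ ^ 2 ∂μ := by
        rw [← add_mul, ENNReal.inv_two_add_inv_two, one_mul]

/-- Supplies the Fubini hypothesis of Schur's test: the dominating function is the product of D²
ρ(x)A(x)², A(y)|h(y)| and A(z)|h(z)|, each integrable in its own variable. -/
lemma integrable_weight_mul_mul {α : Type*} [MeasurableSpace α] {μ : Measure α} [SFinite μ]
    {K : α → α → ℝ} {ρ A : α → ℝ} {h : α → ℂ} {D : ℝ}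
    (hK : Measurable fun p : α × α => K p.1 p.2) (hρ : Measurable ρ) (hh : Measurable h)
    (hKA : ∀ x y, |K x y| ≤ D * (A x * A y)) (hρA : Integrable (fun x => ρ x * A x ^ 2) μ)
    (hA : Integrable (fun x => A x * ‖h x‖) μ) :
    Integrable (fun p : α × α × α => ((ρ p.1 * (K p.1 p.2.1 * K p.1 p.2.2) : ℝ) : ℂ) *
      (h p.2.1 * starRingEnd ℂ (h p.2.2))) (μ.prod (μ.prod μ)) := by
  have hdom := (hρA.norm.const_mul (D ^ 2)).mul_prod (hA.mul_prod hA)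
  refine hdom.mono' (Measurable.aestronglyMeasurable ?_) (ae_of_all _ fun p => ?_)
  · have m1 : Measurable fun p : α × α × α => K p.1 p.2.1 :=
      hK.comp (measurable_fst.prodMk measurable_snd.fst)
    have m2 : Measurable fun p : α × α × α => K p.1 p.2.2 :=
      hK.comp (measurable_fst.prodMk measurable_snd.snd)
    have m3 : Measurable fun p : α × α × α => h p.2.1 := hh.comp measurable_snd.fst
    have m4 : Measurable fun p : α × α × α => h p.2.2 := hh.comp measurable_snd.snd
    have m5 : Measurable fun p : α × α × α => starRingEnd ℂ (h p.2.2) :=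
      Complex.continuous_conj.measurable.comp m4
    exact (Complex.measurable_ofReal.comp ((hρ.comp measurable_fst).mul (m1.mul m2))).mul
      (m3.mul m5)
  · obtain ⟨x, y, z⟩ := p
    simp only [norm_mul, Complex.norm_real, RCLike.norm_conj, Real.norm_eq_abs, abs_pow, sq_abs]
    have h1 := hKA x y
    have h2 := hKA x z
    calc |ρ x| * (|K x y| * |K x z|) * (‖h y‖ * ‖h z‖)
        ≤ |ρ x| * ((D * (A x * A y)) * (D * (A x * A z))) * (‖h y‖ * ‖h z‖) := by
          have := (abs_nonneg _).trans h1
          gcongr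
      _ = _ := by ring

/-! ### The measure `omega` and the Bessel heat kernel -/

instance (a : ℝ) : SFinite (omega a) := by unfold omega; infer_instance

lemma measurable_rpow_weight (a : ℝ) : Measurable fun x : ℝ => ENNReal.ofReal (x ^ a) := by
  fun_prop

lemma ae_omega {a : ℝ} {p : ℝ → Prop} (h : ∀ x, 0 < x → p x) : ∀ᵐ x ∂omega a, p x :=
  (withDensity_absolutelyContinuous _ _).ae_le ((ae_restrict_iff' measurableSet_Ioi).2
    (ae_of_all _ h))

lemma integral_omega (a : ℝ) (f : ℝ → ℝ) :
    ∫ x, f x ∂omega a = ∫ x in Ioi 0, f x * x ^ a := by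
  rw [omega, integral_withDensity_eq_integral_toReal_smul (measurable_rpow_weight a)
    (ae_of_all _ fun x => ENNReal.ofReal_lt_top)]
  refine setIntegral_congr_fun measurableSet_Ioi fun x hx => ?_
  have hx : 0 < x := hx
  simp only [smul_eq_mul]
  rw [ENNReal.toReal_ofReal (by positivity), mul_comm]

lemma integrable_omega_iff (a : ℝ) (f : ℝ → ℝ) :
    Integrable f (omega a) ↔ IntegrableOn (fun x => f x * x ^ a) (Ioi 0) := by
  rw [omega, integrable_withDensity_iff (measurable_rpow_weight a)
    (ae_of_all _ fun x => ENNReal.ofReal_lt_top)]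
  refine integrableOn_congr_fun (fun x hx => ?_) measurableSet_Ioi
  have hx : 0 < x := hx
  rw [ENNReal.toReal_ofReal (by positivity)]

/-- The heat kernel of the Bessel operator with respect to `omega (2 * b - 1)`, with
inverse time parameter `δ`. -/
def heat (b δ y z : ℝ) : ℝ :=
  2 * δ ^ b * (exp (-(δ * y ^ 2)) * exp (-(δ * z ^ 2)) * hyp b ((δ * y ^ 2) * (δ * z ^ 2)))

lemma heat_symm (b δ y z : ℝ) : heat b δ y z = heat b δ z y := by
  simp only [heat]; rw [mul_comm (δ * y ^ 2)]; ring

lemma heat_nonneg {b δ : ℝ} (hb : 0 < b) (hδ : 0 < δ) (y z : ℝ) : 0 ≤ heat b δ y z := by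
  have := hyp_nonneg hb (by positivity : 0 ≤ (δ * y ^ 2) * (δ * z ^ 2))
  unfold heat; positivity

lemma continuous_heat {b δ : ℝ} (hb : 0 < b) : Continuous fun p : ℝ × ℝ => heat b δ p.1 p.2 := by
  have := continuous_hyp hb
  unfold heat; fun_prop

/-- Conservation of mass: the Gaussian moments in z cancel the factors Γ(b+m) of `hyp`, leaving
exp(-δy²) times the exponential series of δy². -/
lemma lintegral_heat {b δ : ℝ} (hb : 0 < b) (hδ : 0 < δ) (y : ℝ) :
    ∫⁻ z, ENNReal.ofReal (heat b δ y z) ∂omega (2 * b - 1) = 1 := by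
  set c : ℕ → ℝ := fun m => 2 * δ ^ b * exp (-(δ * y ^ 2)) * ((δ * y ^ 2) ^ m * δ ^ m) /
    (m ! * Gamma (b + m)) with hc
  have hc0 : ∀ m, 0 ≤ c m := fun m => by
    have := Gamma_add_nat_pos hb m
    simp only [hc]; positivity
  set f : ℕ → ℝ → ℝ := fun m z => c m * (z ^ (2 * m) * exp (-δ * z ^ 2)) with hf
  have hf0 : ∀ m z, 0 ≤ f m z := fun m z => by
    have := hc0 m
    simp only [hf, pow_mul]; positivity
  have hsum : ∀ z, HasSum (fun m => f m z) (heat b δ y z) := by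
    intro z
    have := ((hasSum_hyp hb ((δ * y ^ 2) * (δ * z ^ 2))).mul_left
      (exp (-(δ * y ^ 2)) * exp (-(δ * z ^ 2)))).mul_left (2 * δ ^ b)
    refine this.congr_fun fun m => ?_
    simp only [hf, hc]
    rw [mul_pow (δ * y ^ 2), mul_pow δ (z ^ 2), ← pow_mul, neg_mul]
    ring
  have hrw : ∀ m, ∀ z ∈ Ioi (0 : ℝ), f m z * z ^ (2 * b - 1) =
      c m * (z ^ (2 * (b + m) - 1) * exp (-δ * z ^ 2)) := by
    intro m z hz
    have hz : 0 < z := hz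
    simp only [hf]
    rw [show 2 * (b + (m : ℝ)) - 1 = ((2 * m : ℕ) : ℝ) + (2 * b - 1) by push_cast; ring,
      rpow_add hz, rpow_natCast]
    ring
  have hintg : ∀ m, Integrable (f m) (omega (2 * b - 1)) := by
    intro m
    rw [integrable_omega_iff, integrableOn_congr_fun (hrw m) measurableSet_Ioi]
    exact (integrableOn_gaussian_moment (by positivity) hδ).const_mul _
  have hval : ∀ m, ∫ z, f m z ∂omega (2 * b - 1) = exp (-(δ * y ^ 2)) * ((δ * y ^ 2) ^ m / m !) := by
    intro m
    rw [integral_omega, setIntegral_congr_fun measurableSet_Ioi (hrw m), integral_const_mul,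
      integral_gaussian_moment (by positivity) hδ, neg_add, rpow_add hδ, rpow_neg hδ.le,
      rpow_neg hδ.le, rpow_natCast]
    have := (Gamma_add_nat_pos hb m).ne'
    have : δ ^ b ≠ 0 := by positivity
    simp only [hc]
    field_simp
  have hexp : HasSum (fun m : ℕ => exp (-(δ * y ^ 2)) * ((δ * y ^ 2) ^ m / (m ! : ℝ))) 1 := by
    have h := NormedSpace.expSeries_div_hasSum_exp (δ * y ^ 2)
    rw [← Real.exp_eq_exp_ℝ] at h
    have := h.mul_left (exp (-(δ * y ^ 2)))
    rwa [← exp_add, neg_add_cancel, exp_zero] at this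
  have e : ∀ z, ENNReal.ofReal (heat b δ y z) = ∑' m, ENNReal.ofReal (f m z) := by
    intro z
    rw [← (hsum z).tsum_eq, ENNReal.ofReal_tsum_of_nonneg (fun m => hf0 m z) (hsum z).summable]
  simp only [e]
  rw [lintegral_tsum fun m => (hintg m).aestronglyMeasurable.aemeasurable.ennreal_ofReal]
  have e2 : ∀ m, ∫⁻ z, ENNReal.ofReal (f m z) ∂omega (2 * b - 1) =
      ENNReal.ofReal (exp (-(δ * y ^ 2)) * ((δ * y ^ 2) ^ m / (m ! : ℝ))) := by
    intro m
    rw [← ofReal_integral_eq_lintegral_ofReal (hintg m) (ae_of_all _ (hf0 m)), hval]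
  simp only [e2]
  rw [← ENNReal.ofReal_tsum_of_nonneg (fun m => by positivity) hexp.summable, hexp.tsum_eq,
    ENNReal.ofReal_one]

/-! ### The Hankel transform on L² -/

/-- The dilated Hankel kernel `τ^(-b) z^(1-b) J_(b-1)(z)`, `z = x y / τ`. -/
def hankelKernel (b τ x y : ℝ) : ℝ := 2 ^ (1 - b) * τ ^ (-b) * hyp b (-(x * y / (2 * τ)) ^ 2)

lemma continuous_hankelKernel {b τ : ℝ} (hb : 0 < b) :
    Continuous fun p : ℝ × ℝ => hankelKernel b τ p.1 p.2 := by
  have := continuous_hyp hb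
  unfold hankelKernel; fun_prop

/-- Weber's integral with p = (y/2τ)² and q = (z/2τ)². It computes the TT* kernel of the
Gaussian-weighted Hankel transform. -/
lemma integral_gaussian_hankelKernel {b τ ε : ℝ} (hb : 0 < b) (hτ : 0 < τ) (hε : 0 < ε) (y z : ℝ) :
    ∫ x, exp (-ε * x ^ 2) * (hankelKernel b τ x y * hankelKernel b τ x z) ∂omega (2 * b - 1) =
      heat b (4 * τ ^ 2 * ε)⁻¹ y z := by
  have h := integral_weber hb hε ((y / (2 * τ)) ^ 2) ((z / (2 * τ)) ^ 2)
  rw [integral_omega]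
  have e : ∀ x, exp (-ε * x ^ 2) * (hankelKernel b τ x y * hankelKernel b τ x z) *
      x ^ (2 * b - 1) = (2 ^ (1 - b) * τ ^ (-b)) ^ 2 * (exp (-ε * x ^ 2) *
      (hyp b (-((y / (2 * τ)) ^ 2 * x ^ 2)) * hyp b (-((z / (2 * τ)) ^ 2 * x ^ 2))) *
      x ^ (2 * b - 1)) := by
    intro x
    simp only [hankelKernel]
    rw [show -(x * y / (2 * τ)) ^ 2 = -((y / (2 * τ)) ^ 2 * x ^ 2) by ring,
      show -(x * z / (2 * τ)) ^ 2 = -((z / (2 * τ)) ^ 2 * x ^ 2) by ring]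
    ring
  simp only [e]
  rw [integral_const_mul, h, heat]
  have e1 : (4 * τ ^ 2 * ε)⁻¹ * y ^ 2 = (y / (2 * τ)) ^ 2 / ε := by field_simp; ring
  have e2 : (4 * τ ^ 2 * ε)⁻¹ * z ^ 2 = (z / (2 * τ)) ^ 2 / ε := by field_simp; ring
  have e3 : (2 ^ (1 - b) * τ ^ (-b)) ^ 2 * (1 / 2 * ε ^ (-b)) = 2 * (4 * τ ^ 2 * ε)⁻¹ ^ b := by
    rw [inv_rpow (by positivity), mul_rpow (by positivity) hε.le, mul_rpow (by norm_num)
      (by positivity), rpow_sub two_pos, rpow_one, rpow_neg hτ.le, rpow_neg hε.le,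
      show (4 : ℝ) = 2 ^ (2 : ℕ) by norm_num, ← rpow_pow_comm two_pos.le, ← rpow_pow_comm hτ.le]
    have : (2 : ℝ) ^ b ≠ 0 := by positivity
    have : τ ^ b ≠ 0 := by positivity
    have : ε ^ b ≠ 0 := by positivity
    field_simp
  rw [e1, e2, ← e3]
  rw [show (y / (2 * τ)) ^ 2 / ε * ((z / (2 * τ)) ^ 2 / ε) =
    (y / (2 * τ)) ^ 2 * (z / (2 * τ)) ^ 2 / ε ^ 2 by field_simp]
  ring

/-- A crude linear bound, uniform in the two regimes of b, since 1/2 - b < 1. It serves only for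
absolute convergence and for Fubini. -/
lemma exists_abs_hyp_neg_sq_le {b : ℝ} (hb : 0 < b) :
    ∃ C, 0 < C ∧ ∀ s, |hyp b (-s ^ 2)| ≤ C * (1 + |s|) := by
  rcases le_or_gt (1 / 2) b with h | h
  · have hG : 0 < (Gamma b)⁻¹ := inv_pos.2 (Gamma_pos_of_pos hb)
    refine ⟨(Gamma b)⁻¹, hG, fun s => (abs_hyp_neg_le h (sq_nonneg s)).trans ?_⟩
    nlinarith [abs_nonneg s]
  · obtain ⟨C, hC, hC'⟩ := exists_abs_hyp_neg_le hb h
    refine ⟨2 * C, by positivity, fun s => (hC' _ (sq_nonneg s)).trans ?_⟩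
    have : (s ^ 2) ^ ((1 / 2 - b) / 2) ≤ 1 + |s| := by
      rw [← sq_abs, ← rpow_natCast, ← rpow_mul (abs_nonneg s)]
      refine (rpow_le_rpow (abs_nonneg s) (by linarith : |s| ≤ 1 + |s|) ?_).trans ?_
      · push_cast; linarith
      · refine (rpow_le_rpow_of_exponent_le (by linarith [abs_nonneg s])
          (?_ : _ ≤ (1 : ℝ))).trans (by rw [rpow_one])
        push_cast; linarith
    nlinarith [abs_nonneg s]

lemma exists_abs_hankelKernel_le {b τ : ℝ} (hb : 0 < b) (hτ : 0 < τ) :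
    ∃ D, 0 < D ∧ ∀ x y, |hankelKernel b τ x y| ≤ D * ((1 + |x|) * (1 + |y|)) := by
  obtain ⟨C, hC, h⟩ := exists_abs_hyp_neg_sq_le hb
  refine ⟨2 ^ (1 - b) * τ ^ (-b) * (C * (1 + 1 / (2 * τ))), by positivity, fun x y => ?_⟩
  rw [hankelKernel, abs_mul, abs_of_pos (by positivity : 0 < (2 : ℝ) ^ (1 - b) * τ ^ (-b)),
    mul_assoc (2 ^ (1 - b) * τ ^ (-b)), mul_assoc C]
  gcongr
  refine (h _).trans ?_
  gcongr
  rw [abs_div, abs_mul, abs_of_pos (by positivity : 0 < 2 * τ)]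
  have : 0 < 1 / (2 * τ) := by positivity
  have h3 : |x| * |y| / (2 * τ) = 1 / (2 * τ) * (|x| * |y|) := by ring
  rw [h3]
  nlinarith [abs_nonneg x, abs_nonneg y, mul_nonneg (abs_nonneg x) (abs_nonneg y),
    mul_nonneg this.le (abs_nonneg x), mul_nonneg this.le (abs_nonneg y)]

lemma integrable_gaussian_mul_sq {b ε : ℝ} (hb : 0 < b) (hε : 0 < ε) :
    Integrable (fun x => exp (-ε * x ^ 2) * (1 + |x|) ^ 2) (omega (2 * b - 1)) := by
  rw [integrable_omega_iff]
  have h := ((integrableOn_gaussian_moment hb hε).const_mul 2).add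
    ((integrableOn_gaussian_moment (by positivity : 0 < b + 1) hε).const_mul 2)
  refine h.mono' (Measurable.aestronglyMeasurable (by fun_prop)) ?_
  refine (ae_restrict_iff' measurableSet_Ioi).2 (ae_of_all _ fun x hx => ?_)
  have hx : 0 < x := hx
  rw [Real.norm_of_nonneg (by positivity), abs_of_pos hx]
  simp only [Pi.add_apply]
  rw [show 2 * (b + 1) - 1 = 2 * b - 1 + ((2 : ℕ) : ℝ) by push_cast; ring, rpow_add hx,
    rpow_natCast]
  have : 0 < exp (-ε * x ^ 2) * x ^ (2 * b - 1) := by positivity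
  nlinarith [mul_nonneg this.le (sq_nonneg (1 - x))]

lemma integrable_gaussian_hankelKernel {b τ ε : ℝ} (hb : 0 < b) (hτ : 0 < τ) (hε : 0 < ε)
    {h : ℝ → ℂ} (hh : Measurable h)
    (hintg : Integrable (fun y => (1 + |y|) * ‖h y‖) (omega (2 * b - 1))) :
    Integrable (fun p : ℝ × ℝ × ℝ =>
      ((exp (-ε * p.1 ^ 2) * (hankelKernel b τ p.1 p.2.1 * hankelKernel b τ p.1 p.2.2) : ℝ) : ℂ) *
        (h p.2.1 * starRingEnd ℂ (h p.2.2)))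
      ((omega (2 * b - 1)).prod ((omega (2 * b - 1)).prod (omega (2 * b - 1)))) := by
  obtain ⟨D, hD, hKD⟩ := exists_abs_hankelKernel_le hb hτ
  exact integrable_weight_mul_mul (K := hankelKernel b τ) (ρ := fun x => exp (-ε * x ^ 2))
    (A := fun x => 1 + |x|) (continuous_hankelKernel hb).measurable (by fun_prop) hh hKD
    (integrable_gaussian_mul_sq hb hε) hintg

/-- The (dilated) Hankel transform is a contraction of `L²`. -/
theorem lintegral_hankel_sq_le {b τ : ℝ} (hb : 0 < b) (hτ : 0 < τ) {h : ℝ → ℂ}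
    (hh : Measurable h) (hintg : Integrable (fun y => (1 + |y|) * ‖h y‖) (omega (2 * b - 1))) :
    ∫⁻ x, ‖∫ y, (hankelKernel b τ x y : ℂ) * h y ∂omega (2 * b - 1)‖ₑ ^ 2 ∂omega (2 * b - 1) ≤
      ∫⁻ x, ‖h x‖ₑ ^ 2 ∂omega (2 * b - 1) := by
  set μ := omega (2 * b - 1) with hμ
  set N : ℝ → ℂ := fun x => ∫ y, (hankelKernel b τ x y : ℂ) * h y ∂μ with hN
  have hKm : Measurable fun p : ℝ × ℝ => hankelKernel b τ p.1 p.2 :=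
    (continuous_hankelKernel hb).measurable
  have hNm : Measurable N := by
    refine (StronglyMeasurable.integral_prod_right (f := fun x y => (hankelKernel b τ x y : ℂ) * h y)
      ?_).measurable
    refine Measurable.stronglyMeasurable ?_
    exact (Complex.measurable_ofReal.comp hKm).mul (hh.comp measurable_snd)
  -- The heat kernel has mass 1 whatever its time parameter, so Schur's test gives a bound
  -- independent of ε.
  have key : ∀ ε, 0 < ε → ∫⁻ x, ENNReal.ofReal (exp (-ε * x ^ 2)) * ‖N x‖ₑ ^ 2 ∂μ ≤
      ∫⁻ x, ‖h x‖ₑ ^ 2 ∂μ := by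
    intro ε hε
    have hδ : 0 < (4 * τ ^ 2 * ε)⁻¹ := by positivity
    refine lintegral_weight_mul_sq_le (K := hankelKernel b τ) (G := heat b (4 * τ ^ 2 * ε)⁻¹)
      (ρ := fun x => exp (-ε * x ^ 2)) hh (fun x => (exp_pos _).le) ?_
      (integral_gaussian_hankelKernel hb hτ hε) (heat_nonneg hb hδ)
      (continuous_heat hb).measurable (heat_symm _ _) (fun y => (lintegral_heat hb hδ y).le)
    exact integrable_gaussian_hankelKernel hb hτ hε hh hintg
  -- The Gaussian weight is removed along ε = 1/(n+1) by Fatou's lemma.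
  have hlim : ∀ x, ‖N x‖ₑ ^ 2 = liminf (fun n : ℕ =>
      ENNReal.ofReal (exp (-(1 / ((n : ℝ) + 1)) * x ^ 2)) * ‖N x‖ₑ ^ 2) atTop := by
    intro x
    refine (Tendsto.liminf_eq ?_).symm
    have h1 : Tendsto (fun n : ℕ => exp (-(1 / ((n : ℝ) + 1)) * x ^ 2)) atTop (𝓝 1) := by
      have := ((tendsto_one_div_add_atTop_nhds_zero_nat (𝕜 := ℝ)).neg.mul_const (x ^ 2))
      have h2 := (continuous_exp.tendsto _).comp this
      simpa [Function.comp_def] using h2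
    have h2 := ENNReal.Tendsto.mul_const (b := ‖N x‖ₑ ^ 2) (ENNReal.tendsto_ofReal h1) (Or.inl (by simp))
    simpa using h2
  calc ∫⁻ x, ‖N x‖ₑ ^ 2 ∂μ
      = ∫⁻ x, liminf (fun n : ℕ =>
          ENNReal.ofReal (exp (-(1 / ((n : ℝ) + 1)) * x ^ 2)) * ‖N x‖ₑ ^ 2) atTop ∂μ :=
        lintegral_congr hlim
    _ ≤ liminf (fun n : ℕ => ∫⁻ x,
          ENNReal.ofReal (exp (-(1 / ((n : ℝ) + 1)) * x ^ 2)) * ‖N x‖ₑ ^ 2 ∂μ) atTop := by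
        refine lintegral_liminf_le fun n => ?_
        fun_prop
    _ ≤ ∫⁻ x, ‖h x‖ₑ ^ 2 ∂μ :=
        liminf_le_of_le (by isBoundedDefault) fun c hc => by
          obtain ⟨n, hn⟩ := hc.exists
          exact hn.trans (key _ (by positivity))

/-! ### Interpolation between L¹ → L^∞ and L² → L² -/

lemma lintegral_Ioc_rpow {r L : ℝ} (hr : 2 < r) (hL : 0 ≤ L) :
    ∫⁻ l in Ioc 0 L, ENNReal.ofReal (l ^ (r - 3)) = ENNReal.ofReal (L ^ (r - 2) / (r - 2)) := by
  have hintg : IntegrableOn (fun l : ℝ => l ^ (r - 3)) (Ioc 0 L) :=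
    (intervalIntegrable_iff_integrableOn_Ioc_of_le hL).1
      (intervalIntegral.intervalIntegrable_rpow' (by linarith))
  rw [← ofReal_integral_eq_lintegral_ofReal hintg, ← intervalIntegral.integral_of_le hL,
    integral_rpow (Or.inl (by linarith)), show r - 3 + 1 = r - 2 by ring,
    zero_rpow (by linarith), sub_zero]
  exact (ae_restrict_iff' measurableSet_Ioc).2 (ae_of_all _ fun l hl => rpow_nonneg hl.1.le _)

/-- The level integral in the interpolation argument. -/
lemma lintegral_level {r Q v : ℝ} (hr : 2 < r) (hQ : 0 < Q) (hv : 0 ≤ v) :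
    ∫⁻ l in Ioi 0, ENNReal.ofReal (4 * l ^ (r - 3)) *
        (if v ≤ (Q / l) ^ (r - 1) then ENNReal.ofReal (v ^ 2) else 0) ≤
      ENNReal.ofReal (4 / (r - 2) * Q ^ (r - 2)) * ENNReal.ofReal (v ^ (r / (r - 1))) := by
  rcases hv.eq_or_lt with rfl | hv
  · simp
  have hr1 : 0 < r - 1 := by linarith
  have hr2 : 0 < r - 2 := by linarith
  -- L is the level at which the condition v ≤ (Q/l)^(r-1) stops holding. The resulting power of v
  -- is 2 - (r-2)/(r-1) = r/(r-1).
  set L := Q * v ^ (-(1 / (r - 1))) with hL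
  have hL0 : 0 < L := by positivity
  have hle : ∀ l, 0 < l → v ≤ (Q / l) ^ (r - 1) → l ≤ L := by
    intro l hl h
    have h1 : v ^ (1 / (r - 1)) ≤ Q / l := by
      have := rpow_le_rpow hv.le h (by positivity : 0 ≤ 1 / (r - 1))
      rwa [← rpow_mul (by positivity), mul_one_div_cancel hr1.ne', rpow_one] at this
    rw [hL, rpow_neg hv.le, ← div_eq_mul_inv, le_div_iff₀ (by positivity)]
    rwa [le_div_iff₀ hl, mul_comm] at h1
  calc ∫⁻ l in Ioi 0, ENNReal.ofReal (4 * l ^ (r - 3)) *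
        (if v ≤ (Q / l) ^ (r - 1) then ENNReal.ofReal (v ^ 2) else 0)
      ≤ ∫⁻ l in Ioi 0, (Ioc 0 L).indicator
          (fun l => ENNReal.ofReal (l ^ (r - 3)) * ENNReal.ofReal (4 * v ^ 2)) l := by
        refine setLIntegral_mono' measurableSet_Ioi fun l hl => ?_
        have hl : 0 < l := hl
        split_ifs with h
        · rw [indicator_of_mem (show l ∈ Ioc 0 L from ⟨hl, hle l hl h⟩),
            ← ENNReal.ofReal_mul (by positivity), ← ENNReal.ofReal_mul (by positivity)]
          exact (congrArg _ (by ring)).le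
        · simp
    _ ≤ ∫⁻ l in Ioc 0 L, ENNReal.ofReal (l ^ (r - 3)) * ENNReal.ofReal (4 * v ^ 2) := by
        refine (setLIntegral_le_lintegral _ _).trans ?_
        rw [lintegral_indicator measurableSet_Ioc]
    _ = ENNReal.ofReal (L ^ (r - 2) / (r - 2)) * ENNReal.ofReal (4 * v ^ 2) := by
        rw [lintegral_mul_const _ (by fun_prop), lintegral_Ioc_rpow hr hL0.le]
    _ = _ := by
        rw [← ENNReal.ofReal_mul (by positivity), ← ENNReal.ofReal_mul (by positivity)]
        congr 1
        rw [hL, mul_rpow hQ.le (by positivity), ← rpow_mul hv.le,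
          show r / (r - 1) = -(1 / (r - 1)) * (r - 2) + ((2 : ℕ) : ℝ) by push_cast; field_simp; ring,
          rpow_add hv, rpow_natCast]
        ring

/-- Real interpolation between `L¹ → L^∞` and `L² → L²` for the truncations `T A` of an operator
applied to a fixed function `h` multiplied by the indicator of `A`. -/
theorem lintegral_rpow_le_of_interpolation {α : Type*} [MeasurableSpace α] {μ : Measure α}
    [SFinite μ] {h : α → ℂ} (hh : Measurable h) {T : Set α → α → ℂ} {B r : ℝ} (hB : 0 < B)
    (hr : 2 < r) (hTm : ∀ A, MeasurableSet A → AEMeasurable (T A) μ)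
    (hadd : ∀ A, MeasurableSet A → ∀ᵐ x ∂μ, T univ x = T A x + T Aᶜ x)
    (h1 : ∀ A, MeasurableSet A →
      ∀ᵐ x ∂μ, ‖T A x‖ₑ ≤ ENNReal.ofReal B * ∫⁻ y in A, ‖h y‖ₑ ∂μ)
    (h2 : ∀ A, MeasurableSet A → ∫⁻ x, ‖T A x‖ₑ ^ 2 ∂μ ≤ ∫⁻ y in A, ‖h y‖ₑ ^ 2 ∂μ)
    (hfin : ∫⁻ y, ‖h y‖ₑ ^ (r / (r - 1)) ∂μ ≠ ⊤) :
    ∫⁻ x, ‖T univ x‖ₑ ^ r ∂μ ≤ ENNReal.ofReal (4 * r / (r - 2) * (2 * B) ^ (r - 2)) *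
      (∫⁻ y, ‖h y‖ₑ ^ (r / (r - 1)) ∂μ) ^ (r - 1) := by
  have hr1 : 0 < r - 1 := by linarith
  have hr2 : 0 < r - 2 := by linarith
  set p := r / (r - 1) with hp
  have hp0 : 0 < p := by positivity
  have hp1 : p - 1 = 1 / (r - 1) := by rw [hp]; field_simp; ring
  set I := ∫⁻ y, ‖h y‖ₑ ^ p ∂μ with hI
  rcases eq_or_ne I 0 with hI0 | hI0
  · have hh0 : ∀ᵐ y ∂μ, ‖h y‖ₑ ^ p = 0 := by
      have := (lintegral_eq_zero_iff (hh.enorm.pow_const p)).1 hI0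
      exact this
    have hz : ∫⁻ y in univ, ‖h y‖ₑ ^ 2 ∂μ = 0 := by
      rw [Measure.restrict_univ, lintegral_eq_zero_iff (hh.enorm.pow_const 2)]
      filter_upwards [hh0] with y hy
      rw [ENNReal.rpow_eq_zero_iff_of_pos hp0] at hy
      simp [hy]
    have hT0 : ∫⁻ x, ‖T univ x‖ₑ ^ 2 ∂μ = 0 := le_antisymm ((h2 univ .univ).trans hz.le) zero_le
    rw [lintegral_eq_zero_iff' ((hTm univ .univ).enorm.pow_const 2)] at hT0
    have : ∫⁻ x, ‖T univ x‖ₑ ^ r ∂μ = 0 := by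
      rw [lintegral_eq_zero_iff' ((hTm univ .univ).enorm.pow_const r)]
      filter_upwards [hT0] with x hx
      have : ‖T univ x‖ₑ = 0 := by simpa using hx
      simp [this]; linarith
    rw [this]; exact zero_le
  set P := I.toReal with hP
  have hP0 : 0 < P := ENNReal.toReal_pos hI0 hfin
  have hIP : I = ENNReal.ofReal P := (ENNReal.ofReal_toReal hfin).symm
  set Q := 2 * B * P with hQ
  have hQ0 : 0 < Q := by positivity
  have hlevel : ∀ l, 0 < l → μ {x | l < ‖T univ x‖} ≤ ENNReal.ofReal (4 / l ^ 2) *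
      ∫⁻ y, (if ‖h y‖ ≤ (Q / l) ^ (r - 1) then ENNReal.ofReal (‖h y‖ ^ 2) else 0) ∂μ := by
    intro l hl
    -- The height s is chosen so that the part of h above s is sent below l/2 in L^∞: as (r-1)(1-p)
    -- = -1, B s^(1-p) P = B P l/Q = l/2, which also dictates Q = 2BP.
    set s := (Q / l) ^ (r - 1) with hs
    have hs0 : 0 < s := by positivity
    set A : Set α := {y | s < ‖h y‖} with hA
    have hAm : MeasurableSet A := measurableSet_lt measurable_const hh.norm
    have hsmall : ENNReal.ofReal B * ∫⁻ y in A, ‖h y‖ₑ ∂μ ≤ ENNReal.ofReal (l / 2) := by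
      have hb1 : ∫⁻ y in A, ‖h y‖ₑ ∂μ ≤ ∫⁻ y in A, ENNReal.ofReal (s ^ (1 - p)) * ‖h y‖ₑ ^ p ∂μ := by
        refine setLIntegral_mono' hAm fun y hy => ?_
        have hy : s < ‖h y‖ := hy
        have hy0 : 0 < ‖h y‖ := hs0.trans hy
        rw [← ofReal_norm, ENNReal.ofReal_rpow_of_pos hy0, ← ENNReal.ofReal_mul (by positivity)]
        refine ENNReal.ofReal_le_ofReal ?_
        calc ‖h y‖ = ‖h y‖ ^ (1 - p) * ‖h y‖ ^ p := by
              rw [← rpow_add hy0, sub_add_cancel, rpow_one]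
          _ ≤ s ^ (1 - p) * ‖h y‖ ^ p := by
              gcongr ?_ * _
              refine rpow_le_rpow_of_nonpos hs0 hy.le ?_
              have : 0 < 1 / (r - 1) := by positivity
              linarith
      have hb2 : ∫⁻ y in A, ENNReal.ofReal (s ^ (1 - p)) * ‖h y‖ₑ ^ p ∂μ ≤
          ENNReal.ofReal (s ^ (1 - p)) * ENNReal.ofReal P := by
        rw [lintegral_const_mul _ (hh.enorm.pow_const p), ← hIP]
        gcongr
        exact setLIntegral_le_lintegral _ _
      refine (mul_le_mul_right (hb1.trans hb2) _).trans ?_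
      rw [← ENNReal.ofReal_mul (by positivity), ← ENNReal.ofReal_mul hB.le]
      refine ENNReal.ofReal_le_ofReal (le_of_eq ?_)
      rw [hs, ← rpow_mul (by positivity), show (r - 1) * (1 - p) = -1 by
        rw [show 1 - p = -(p - 1) by ring, hp1]; field_simp, rpow_neg_one, hQ]
      field_simp
    -- Where the full operator exceeds l, the truncation to small values of h must exceed l/2;
    -- Chebyshev and the L² bound then apply to that truncation.
    have hsub : μ {x | l < ‖T univ x‖} ≤ μ {x | ENNReal.ofReal ((l / 2) ^ 2) ≤ ‖T Aᶜ x‖ₑ ^ 2} := by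
      refine measure_mono_ae ?_
      filter_upwards [hadd A hAm, h1 A hAm] with x hx1 hx2 hx
      have hx : l < ‖T univ x‖ := hx
      have hx3 : ‖T A x‖ ≤ l / 2 := by
        have := hx2.trans hsmall
        rwa [← ofReal_norm, ENNReal.ofReal_le_ofReal_iff (by positivity)] at this
      have hx4 : l / 2 ≤ ‖T Aᶜ x‖ := by
        rw [hx1] at hx
        linarith [norm_add_le (T A x) (T Aᶜ x)]
      change ENNReal.ofReal ((l / 2) ^ 2) ≤ ‖T Aᶜ x‖ₑ ^ 2
      rw [← ofReal_norm, ← ENNReal.ofReal_pow (norm_nonneg _)]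
      exact ENNReal.ofReal_le_ofReal (by gcongr)
    have hcheb := mul_meas_ge_le_lintegral₀ ((hTm Aᶜ hAm.compl).enorm.pow_const 2)
      (ENNReal.ofReal ((l / 2) ^ 2))
    have hmul : ENNReal.ofReal (4 / l ^ 2) * ENNReal.ofReal ((l / 2) ^ 2) = 1 := by
      rw [← ENNReal.ofReal_mul (by positivity), show 4 / l ^ 2 * (l / 2) ^ 2 = 1 by
        field_simp; norm_num, ENNReal.ofReal_one]
    calc μ {x | l < ‖T univ x‖}
        ≤ μ {x | ENNReal.ofReal ((l / 2) ^ 2) ≤ ‖T Aᶜ x‖ₑ ^ 2} := hsub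
      _ = ENNReal.ofReal (4 / l ^ 2) * (ENNReal.ofReal ((l / 2) ^ 2) *
            μ {x | ENNReal.ofReal ((l / 2) ^ 2) ≤ ‖T Aᶜ x‖ₑ ^ 2}) := by
          rw [← mul_assoc, hmul, one_mul]
      _ ≤ ENNReal.ofReal (4 / l ^ 2) * ∫⁻ y in Aᶜ, ‖h y‖ₑ ^ 2 ∂μ := by
          gcongr
          exact hcheb.trans (h2 _ hAm.compl)
      _ ≤ _ := by
          gcongr ENNReal.ofReal (4 / l ^ 2) * ?_
          rw [← lintegral_indicator hAm.compl]
          refine lintegral_mono fun y => ?_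
          by_cases hy : ‖h y‖ ≤ s
          · rw [indicator_of_mem (by simpa [hA] using hy), if_pos hy, ← ofReal_norm,
              ENNReal.ofReal_pow (norm_nonneg _)]
          · rw [indicator_of_notMem (by simpa [hA] using hy)]; exact zero_le
  have hm : Measurable fun q : ℝ × α => ENNReal.ofReal (4 * q.1 ^ (r - 3)) *
      (if ‖h q.2‖ ≤ (Q / q.1) ^ (r - 1) then ENNReal.ofReal (‖h q.2‖ ^ 2) else 0) := by
    have m1 : Measurable fun q : ℝ × α => ‖h q.2‖ := hh.norm.comp measurable_snd
    have m2 : Measurable fun q : ℝ × α => (Q / q.1) ^ (r - 1) := by fun_prop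
    have m3 : Measurable fun q : ℝ × α => ENNReal.ofReal (4 * q.1 ^ (r - 3)) := by fun_prop
    exact m3.mul (Measurable.ite (measurableSet_le m1 m2) (m1.pow_const 2).ennreal_ofReal
      measurable_const)
  have hm2 : ∀ l : ℝ, Measurable fun y =>
      (if ‖h y‖ ≤ (Q / l) ^ (r - 1) then ENNReal.ofReal (‖h y‖ ^ 2) else 0) := fun l =>
    Measurable.ite (measurableSet_le hh.norm measurable_const) (hh.norm.pow_const 2).ennreal_ofReal
      measurable_const
  -- Layer-cake formula, level estimate, then Tonelli, so that the integral over levels is computed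
  -- for each fixed value of |h(y)|.
  calc ∫⁻ x, ‖T univ x‖ₑ ^ r ∂μ = ∫⁻ x, ENNReal.ofReal (‖T univ x‖ ^ r) ∂μ := by
        refine lintegral_congr fun x => ?_
        rw [← ofReal_norm, ENNReal.ofReal_rpow_of_nonneg (norm_nonneg _) (by linarith)]
    _ = ENNReal.ofReal r * ∫⁻ l in Ioi 0, μ {x | l < ‖T univ x‖} * ENNReal.ofReal (l ^ (r - 1)) :=
        lintegral_rpow_eq_lintegral_meas_lt_mul μ (ae_of_all _ fun x => norm_nonneg _)
          (hTm univ .univ).norm (by linarith)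
    _ ≤ ENNReal.ofReal r * ∫⁻ l in Ioi 0, ∫⁻ y, ENNReal.ofReal (4 * l ^ (r - 3)) *
          (if ‖h y‖ ≤ (Q / l) ^ (r - 1) then ENNReal.ofReal (‖h y‖ ^ 2) else 0) ∂μ := by
        gcongr ENNReal.ofReal r * ?_
        refine setLIntegral_mono' measurableSet_Ioi fun l hl => ?_
        have hl : 0 < l := hl
        rw [lintegral_const_mul _ (hm2 l)]
        refine (mul_le_mul_left (hlevel l hl) _).trans (le_of_eq ?_)
        rw [mul_right_comm, ← ENNReal.ofReal_mul (by positivity)]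
        congr 2
        rw [show r - 1 = r - 3 + ((2 : ℕ) : ℝ) by push_cast; ring, rpow_add hl, rpow_natCast]
        field_simp
    _ = ENNReal.ofReal r * ∫⁻ y, (∫⁻ l in Ioi 0, ENNReal.ofReal (4 * l ^ (r - 3)) *
          (if ‖h y‖ ≤ (Q / l) ^ (r - 1) then ENNReal.ofReal (‖h y‖ ^ 2) else 0)) ∂μ := by
        rw [lintegral_lintegral_swap hm.aemeasurable]
    _ ≤ ENNReal.ofReal r * ∫⁻ y, ENNReal.ofReal (4 / (r - 2) * Q ^ (r - 2)) * ‖h y‖ₑ ^ p ∂μ := by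
        gcongr with y
        refine (lintegral_level hr hQ0 (norm_nonneg _)).trans (le_of_eq ?_)
        rw [← ofReal_norm (h y), ENNReal.ofReal_rpow_of_nonneg (norm_nonneg _) hp0.le]
    _ = _ := by
        rw [lintegral_const_mul _ (hh.enorm.pow_const p), ← hI, hIP,
          ENNReal.ofReal_rpow_of_pos hP0, ← ENNReal.ofReal_mul (by positivity),
          ← ENNReal.ofReal_mul (by linarith), ← ENNReal.ofReal_mul (by positivity)]
        congr 1
        rw [hQ, mul_rpow (by positivity) hP0.le, show r - 1 = r - 2 + 1 by ring, rpow_add hP0,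
          rpow_one]
        ring

/-! ### Reduction of the Schrödinger kernel to the Hankel kernel -/

/-- The prefactor cancels the power z^ν, ν = (a-1)/2, in the Bessel series and leaves a series in
(z/2)²; the parameter is b = ν + 1. -/
lemma rpow_mul_besselJ {a z : ℝ} (hz : 0 < z) :
    z ^ ((1 - a) / 2) * besselJ ((a - 1) / 2) z =
      2 ^ (1 - (a + 1) / 2) * hyp ((a + 1) / 2) (-(z / 2) ^ 2) := by
  rw [besselJ, hyp, ← tsum_mul_left, ← tsum_mul_left]
  refine tsum_congr fun k => ?_
  have e1 : (z / 2) ^ (2 * (k : ℝ) + (a - 1) / 2) = ((z / 2) ^ 2) ^ k *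
      ((z ^ ((1 - a) / 2))⁻¹ * 2 ^ ((1 - a) / 2)) := by
    rw [rpow_add (by positivity), show 2 * (k : ℝ) = ((2 * k : ℕ) : ℝ) by push_cast; ring,
      rpow_natCast, pow_mul, div_rpow hz.le two_pos.le,
      show (a - 1) / 2 = -((1 - a) / 2) by ring, rpow_neg hz.le, rpow_neg two_pos.le,
      div_inv_eq_mul]
  rw [e1, Gamma_nat_eq_factorial, show (a - 1) / 2 + (k : ℝ) + 1 = (a + 1) / 2 + k by ring,
    show 1 - (a + 1) / 2 = (1 - a) / 2 by ring, neg_pow ((z / 2) ^ 2)]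
  have : z ^ ((1 - a) / 2) ≠ 0 := by positivity
  field_simp

lemma norm_exp_I_mul (s : ℝ) : ‖Complex.exp (Complex.I * (s : ℂ))‖ = 1 := by
  rw [mul_comm]; exact Complex.norm_exp_ofReal_mul_I s

/-- Up to unimodular factors in `x` and in `y`, the kernel is a dilated Hankel kernel. -/
lemma exists_kernel_eq (a : ℝ) {t : ℝ} (ht : t ≠ 0) :
    ∃ (c : ℂ) (χ : ℝ → ℂ), ‖c‖ = 1 ∧ Continuous χ ∧ (∀ x, ‖χ x‖ = 1) ∧
      ∀ x y, 0 < x → 0 < y → kernel a x y t =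
        c * χ x * ((hankelKernel ((a + 1) / 2) (2 * |t|) x y : ℂ) * χ y) := by
  have ht0 : 0 < |t| := abs_pos.2 ht
  have hker : ∀ x y, 0 < x → 0 < y →
      (((x * y / (2 * |t|)) ^ ((1 - a) / 2) * besselJ ((a - 1) / 2) (x * y / (2 * |t|)) : ℝ) : ℂ) /
        (((2 * |t|) ^ ((a + 1) / 2) : ℝ) : ℂ) =
      (hankelKernel ((a + 1) / 2) (2 * |t|) x y : ℂ) := by
    intro x y hx hy
    rw [← Complex.ofReal_div]
    congr 1
    rw [rpow_mul_besselJ (by positivity), hankelKernel, rpow_neg (by positivity),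
      show x * y / (2 * |t|) / 2 = x * y / (2 * (2 * |t|)) by field_simp]
    ring
  have main : ∀ σ : ℝ, ∃ (c : ℂ) (χ : ℝ → ℂ), ‖c‖ = 1 ∧ Continuous χ ∧ (∀ x, ‖χ x‖ = 1) ∧
      ∀ x y, 0 < x → 0 < y →
        Complex.exp (Complex.I * ((-σ * ((a + 1) * Real.pi / 4) : ℝ) : ℂ)) /
        (((2 * |t|) ^ ((a + 1) / 2) : ℝ) : ℂ) *
        (((x * y / (2 * |t|)) ^ ((1 - a) / 2) * besselJ ((a - 1) / 2) (x * y / (2 * |t|)) : ℝ) : ℂ) *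
        Complex.exp (Complex.I * ((σ * ((x ^ 2 + y ^ 2) / (4 * |t|)) : ℝ) : ℂ)) =
        c * χ x * ((hankelKernel ((a + 1) / 2) (2 * |t|) x y : ℂ) * χ y) := by
    intro σ
    refine ⟨Complex.exp (Complex.I * ((-σ * ((a + 1) * Real.pi / 4) : ℝ) : ℂ)),
      fun x => Complex.exp (Complex.I * ((σ * (x ^ 2 / (4 * |t|)) : ℝ) : ℂ)),
      norm_exp_I_mul _, by fun_prop, fun x => norm_exp_I_mul _, fun x y hx hy => ?_⟩
    rw [← hker x y hx hy, show σ * ((x ^ 2 + y ^ 2) / (4 * |t|)) =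
      σ * (x ^ 2 / (4 * |t|)) + σ * (y ^ 2 / (4 * |t|)) by ring, Complex.ofReal_add, mul_add,
      Complex.exp_add]
    ring
  have hneg : ∀ u : ℝ, -Complex.I * (u : ℂ) = Complex.I * ((-1 * u : ℝ) : ℂ) := fun u => by
    push_cast; ring
  by_cases h : t < 0
  · obtain ⟨c, χ, hc, hχ, hχ1, H⟩ := main (-1)
    refine ⟨c, χ, hc, hχ, hχ1, fun x y hx hy => ?_⟩
    rw [← H x y hx hy, kernel, if_pos h]
    simp only [hneg, one_mul, neg_neg]
  · obtain ⟨c, χ, hc, hχ, hχ1, H⟩ := main 1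
    refine ⟨c, χ, hc, hχ, hχ1, fun x y hx hy => ?_⟩
    rw [← H x y hx hy, kernel, if_neg h]
    simp only [hneg, one_mul]

lemma integrable_hankelKernel_mul {b τ : ℝ} (hb : 0 < b) (hτ : 0 < τ) {f : ℝ → ℂ}
    (hf : Measurable f) (hintg : Integrable (fun y => (1 + |y|) * ‖f y‖) (omega (2 * b - 1)))
    (x : ℝ) : Integrable (fun y => (hankelKernel b τ x y : ℂ) * f y) (omega (2 * b - 1)) := by
  obtain ⟨D, hD, hK⟩ := exists_abs_hankelKernel_le hb hτ
  have hc : Continuous fun y => hankelKernel b τ x y := by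
    have := continuous_hyp hb
    unfold hankelKernel; fun_prop
  refine (hintg.const_mul (D * (1 + |x|))).mono'
    ((Complex.measurable_ofReal.comp hc.measurable).mul hf).aestronglyMeasurable
    (ae_of_all _ fun y => ?_)
  rw [norm_mul, Complex.norm_real, Real.norm_eq_abs]
  calc |hankelKernel b τ x y| * ‖f y‖ ≤ D * ((1 + |x|) * (1 + |y|)) * ‖f y‖ := by
        gcongr; exact hK x y
    _ = _ := by ring

lemma measurable_hankel {b τ : ℝ} (hb : 0 < b) {f : ℝ → ℂ} (hf : Measurable f) :
    Measurable fun x => ∫ y, (hankelKernel b τ x y : ℂ) * f y ∂omega (2 * b - 1) := by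
  refine (StronglyMeasurable.integral_prod_right
    (f := fun x y => (hankelKernel b τ x y : ℂ) * f y) ?_).measurable
  refine Measurable.stronglyMeasurable ?_
  exact (Complex.measurable_ofReal.comp (continuous_hankelKernel hb).measurable).mul
    (hf.comp measurable_snd)

/-! ### Weighted interpolation for the Hankel transform -/

/-- Weighted interpolation for the Hankel transform: the weight is absorbed into the measure
`κ⁻² dω`, with respect to which the modified kernel `κ(x) K(x, y) κ(y)` is bounded. -/
theorem lintegral_weighted_hankel_le {b τ : ℝ} (hb : 0 < b) (hτ : 0 < τ) {κ : ℝ → ℝ}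
    (hκm : Measurable κ) (hκ : ∀ x, 0 < κ x) {B r : ℝ} (hB : 0 < B) (hr : 2 < r)
    (hbound : ∀ x y, 0 < x → 0 < y → κ x * |hankelKernel b τ x y| * κ y ≤ B)
    {f : ℝ → ℂ} (hf : Measurable f)
    (hintg : Integrable (fun y => (1 + |y|) * ‖f y‖) (omega (2 * b - 1)))
    (hfin : ∫⁻ y, (ENNReal.ofReal (κ y) ^ 2)⁻¹ *
      (ENNReal.ofReal (κ y) * ‖f y‖ₑ) ^ (r / (r - 1)) ∂omega (2 * b - 1) ≠ ⊤) :
    ∫⁻ x, (ENNReal.ofReal (κ x) ^ 2)⁻¹ * (ENNReal.ofReal (κ x) *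
        ‖∫ y, (hankelKernel b τ x y : ℂ) * f y ∂omega (2 * b - 1)‖ₑ) ^ r ∂omega (2 * b - 1) ≤
      ENNReal.ofReal (4 * r / (r - 2) * (2 * B) ^ (r - 2)) *
        (∫⁻ y, (ENNReal.ofReal (κ y) ^ 2)⁻¹ *
          (ENNReal.ofReal (κ y) * ‖f y‖ₑ) ^ (r / (r - 1)) ∂omega (2 * b - 1)) ^ (r - 1) := by
  set ν := omega (2 * b - 1) with hν
  set k : ℝ → ℝ≥0∞ := fun x => ENNReal.ofReal (κ x) with hk
  have hkm : Measurable k := hκm.ennreal_ofReal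
  have hk0 : ∀ x, k x ≠ 0 := fun x => by simpa [hk] using hκ x
  have hkt : ∀ x, k x ≠ ⊤ := fun x => ENNReal.ofReal_ne_top
  have hdm : Measurable fun x => (k x ^ 2)⁻¹ := (hkm.pow_const 2).inv
  set μ := ν.withDensity fun x => (k x ^ 2)⁻¹ with hμ
  have hμint : ∀ F : ℝ → ℝ≥0∞, Measurable F → ∫⁻ x, F x ∂μ = ∫⁻ x, (k x ^ 2)⁻¹ * F x ∂ν :=
    fun F hF => lintegral_withDensity_eq_lintegral_mul _ hdm hF
  have hμν : μ ≪ ν := withDensity_absolutelyContinuous _ _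
  set N : Set ℝ → ℝ → ℂ := fun A x => ∫ y, (hankelKernel b τ x y : ℂ) * A.indicator f y ∂ν with hN
  have hindm : ∀ A, MeasurableSet A → Measurable (A.indicator f) := fun A hA => hf.indicator hA
  have hindint : ∀ A, MeasurableSet A → Integrable (fun y => (1 + |y|) * ‖A.indicator f y‖) ν := by
    intro A hA
    refine (hintg.indicator hA).congr (ae_of_all _ fun y => ?_)
    by_cases hy : y ∈ A <;> simp [hy]
  have hNm : ∀ A, MeasurableSet A → Measurable (N A) := fun A hA =>
    measurable_hankel hb (hindm A hA)
  set h : ℝ → ℂ := fun x => (κ x : ℂ) * f x with hh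
  have hhm : Measurable h := (Complex.measurable_ofReal.comp hκm).mul hf
  have hκe : ∀ x, ‖(κ x : ℂ)‖ₑ = k x := fun x => by
    rw [← ofReal_norm, Complex.norm_real, Real.norm_of_nonneg (hκ x).le]
  have hhe : ∀ x, ‖h x‖ₑ = k x * ‖f x‖ₑ := fun x => by simp only [hh, enorm_mul, hκe]
  -- At exponent 2 the weight κ² cancels the density κ⁻², so the L² bound is the unweighted
  -- contraction.
  have hsq : ∀ x (n : ℝ≥0∞), (k x ^ 2)⁻¹ * (k x * n) ^ 2 = n ^ 2 := fun x n => by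
    rw [mul_pow, ← mul_assoc, ENNReal.inv_mul_cancel (pow_ne_zero 2 (hk0 x))
      (ENNReal.pow_ne_top (hkt x)), one_mul]
  have hTm : ∀ A, MeasurableSet A → Measurable fun x => (κ x : ℂ) * N A x := fun A hA =>
    (Complex.measurable_ofReal.comp hκm).mul (hNm A hA)
  have key := lintegral_rpow_le_of_interpolation (μ := μ) hhm (T := fun A x => (κ x : ℂ) * N A x)
    hB hr (fun A hA => (hTm A hA).aemeasurable)
    (fun A hA => ae_of_all _ fun x => ?_) (fun A hA => ?_) (fun A hA => ?_) ?_
  · have e1 : ∫⁻ x, ‖(κ x : ℂ) * N univ x‖ₑ ^ r ∂μ =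
        ∫⁻ x, (k x ^ 2)⁻¹ * (k x * ‖∫ y, (hankelKernel b τ x y : ℂ) * f y ∂ν‖ₑ) ^ r ∂ν := by
      rw [hμint _ ((hTm univ .univ).enorm.pow_const r)]
      simp only [hN, indicator_univ, enorm_mul, hκe]
    have e2 : ∫⁻ x, ‖h x‖ₑ ^ (r / (r - 1)) ∂μ =
        ∫⁻ y, (k y ^ 2)⁻¹ * (k y * ‖f y‖ₑ) ^ (r / (r - 1)) ∂ν := by
      rw [hμint _ (hhm.enorm.pow_const _)]
      simp only [hhe]
    rwa [e1, e2] at key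
  · simp only [hN]
    rw [← mul_add, ← integral_add
      (integrable_hankelKernel_mul hb hτ (hindm A hA) (hindint A hA) x)
      (integrable_hankelKernel_mul hb hτ (hindm _ hA.compl) (hindint _ hA.compl) x)]
    congr 1
    refine integral_congr_ae (ae_of_all _ fun y => ?_)
    simp only
    rw [← mul_add, indicator_univ]
    congr 1
    exact (congrFun (indicator_self_add_compl A f) y).symm
  · refine hμν.ae_le (ae_omega fun x hx => ?_)
    have hm : Measurable fun y => (k y ^ 2)⁻¹ * A.indicator (fun x => ‖h x‖ₑ) y :=
      hdm.mul (hhm.enorm.indicator hA)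
    rw [← lintegral_indicator hA, hμint _ (hhm.enorm.indicator hA), enorm_mul, hκe,
      ← lintegral_const_mul _ hm]
    refine (mul_le_mul_right (enorm_integral_le_lintegral_enorm _) _).trans ?_
    have hKm : Measurable fun y => (hankelKernel b τ x y : ℂ) * A.indicator f y := by
      have hc : Continuous fun y => hankelKernel b τ x y := by
        have := continuous_hyp hb
        unfold hankelKernel; fun_prop
      exact (Complex.measurable_ofReal.comp hc.measurable).mul (hindm A hA)
    rw [← lintegral_const_mul _ hKm.enorm]
    refine lintegral_mono_ae (ae_omega fun y hy => ?_)
    by_cases hyA : y ∈ A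
    · simp only [indicator_of_mem hyA, enorm_mul, hκe, hh]
      -- In L¹ the density leaves κ(y)⁻¹ on the right-hand side, so the comparison needed is exactly
      -- κ(x) |K(x, y)| κ(y) ≤ B.
      have e3 : (k y ^ 2)⁻¹ * (k y * ‖f y‖ₑ) = (k y)⁻¹ * ‖f y‖ₑ := by
        rw [sq, ENNReal.mul_inv (Or.inl (hk0 y)) (Or.inl (hkt y)), ← mul_assoc, mul_assoc (k y)⁻¹,
          ENNReal.inv_mul_cancel (hk0 y) (hkt y), mul_one]
      rw [e3, ← mul_assoc, ← mul_assoc]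
      gcongr ?_ * _
      rw [← div_eq_mul_inv, ENNReal.le_div_iff_mul_le (Or.inl (hk0 y)) (Or.inl (hkt y)),
        ← ofReal_norm, Complex.norm_real, Real.norm_eq_abs, ← ENNReal.ofReal_mul (hκ x).le,
        ← ENNReal.ofReal_mul (mul_nonneg (hκ x).le (abs_nonneg _))]
      exact ENNReal.ofReal_le_ofReal (hbound x y hx hy)
    · simp [hyA]
  · rw [hμint _ ((hTm A hA).enorm.pow_const 2),
      ← lintegral_indicator hA, hμint _ ((hhm.enorm.pow_const 2).indicator hA)]
    simp only [enorm_mul, hκe, hsq]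
    refine (lintegral_hankel_sq_le hb hτ (hindm A hA) (hindint A hA)).trans (le_of_eq ?_)
    refine lintegral_congr fun y => ?_
    by_cases hyA : y ∈ A
    · simp only [indicator_of_mem hyA, hhe, hsq]
    · simp [hyA]
  · rw [hμint _ (hhm.enorm.pow_const _)]
    simpa only [hhe] using hfin

end Series

/-! ### Integrability of functions in 𝒮⁺ -/

lemma SchwartzPlus.decay {φ : ℝ → ℂ} (hφ : SchwartzPlus φ) (m : ℕ) :
    ∃ M, 0 < M ∧ ∀ x, 0 < x → x ^ m * ‖φ x‖ ≤ M := by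
  obtain ⟨M, hM⟩ := hφ.bounded m 0
  refine ⟨max M 1, by positivity, fun x hx => le_trans (le_of_eq ?_) ((hM x hx).trans (le_max_left _ _))⟩
  rw [norm_mul, norm_pow, Complex.norm_real, Real.norm_of_nonneg hx.le]
  rfl

lemma SchwartzPlus.exists_mul_norm_le {φ : ℝ → ℂ} (hφ : SchwartzPlus φ) :
    ∃ M, 0 < M ∧ ∀ x, 0 < x → (1 + |x|) * ‖φ x‖ ≤ M := by
  obtain ⟨M, hM, h⟩ := hφ.decay 0
  obtain ⟨M', hM', h'⟩ := hφ.decay 1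
  refine ⟨M + M', by positivity, fun x hx => ?_⟩
  have h1 := h x hx
  have h2 := h' x hx
  rw [abs_of_pos hx]
  rw [pow_zero, one_mul] at h1
  rw [pow_one] at h2
  linarith

lemma SchwartzPlus.integrable {φ : ℝ → ℂ} (hφ : SchwartzPlus φ) {a : ℝ} (ha : -1 < a) :
    Integrable (fun y => (1 + |y|) * ‖φ y‖) (omega a) := by
  rw [integrable_omega_iff]
  have hcont : ContinuousOn (fun y => (1 + |y|) * ‖φ y‖ * y ^ a) (Ioi 0) := by
    refine ContinuousOn.mul (ContinuousOn.mul (by fun_prop) hφ.smooth.continuousOn.norm) ?_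
    exact fun y hy => (continuousAt_rpow_const y a (Or.inl (ne_of_gt hy))).continuousWithinAt
  rw [← Ioc_union_Ioi_eq_Ioi (zero_le_one (α := ℝ))]
  refine IntegrableOn.union ?_ ?_
  · obtain ⟨M, hM, h⟩ := hφ.exists_mul_norm_le
    have hd : IntegrableOn (fun y : ℝ => M * y ^ a) (Ioc 0 1) :=
      ((intervalIntegrable_iff_integrableOn_Ioc_of_le zero_le_one).1
        (intervalIntegral.intervalIntegrable_rpow' ha)).const_mul M
    refine hd.mono' ((hcont.mono Ioc_subset_Ioi_self).aestronglyMeasurable measurableSet_Ioc) ?_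
    refine (ae_restrict_iff' measurableSet_Ioc).2 (ae_of_all _ fun y hy => ?_)
    have hy0 : 0 < y := hy.1
    rw [Real.norm_of_nonneg (by positivity)]
    gcongr
    exact h y hy0
  -- Decay of order n ≥ a + 3 makes y · y^a · y^(-n) at most y^(-2) for y > 1.
  · obtain ⟨n, hn⟩ := exists_nat_ge (a + 3)
    obtain ⟨M, hM, h⟩ := hφ.decay n
    have hd : IntegrableOn (fun y : ℝ => 2 * M * y ^ (-2 : ℝ)) (Ioi 1) :=
      (integrableOn_Ioi_rpow_of_lt (by norm_num) one_pos).const_mul _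
    refine hd.mono' ((hcont.mono (Ioi_subset_Ioi zero_le_one)).aestronglyMeasurable
      measurableSet_Ioi) ?_
    refine (ae_restrict_iff' measurableSet_Ioi).2 (ae_of_all _ fun y hy => ?_)
    have hy1 : 1 < y := hy
    have hy0 : 0 < y := by linarith
    rw [Real.norm_of_nonneg (by positivity), abs_of_pos hy0]
    have e1 : y ^ a ≤ y ^ ((n : ℝ) + (-1 + -2)) :=
      rpow_le_rpow_of_exponent_le hy1.le (by linarith)
    rw [rpow_add hy0, rpow_add hy0, rpow_natCast, rpow_neg_one] at e1
    calc (1 + y) * ‖φ y‖ * y ^ a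
        ≤ (2 * y) * ‖φ y‖ * (y ^ n * (y⁻¹ * y ^ (-2 : ℝ))) := by gcongr; linarith
      _ = 2 * (y ^ n * ‖φ y‖) * y ^ (-2 : ℝ) := by field_simp
      _ ≤ 2 * M * y ^ (-2 : ℝ) := by
          gcongr
          exact h y hy0

/-- The values of φ outside (0, ∞) are arbitrary, so φ itself need not be measurable on ℝ. -/
lemma SchwartzPlus.measurable_indicator {φ : ℝ → ℂ} (hφ : SchwartzPlus φ) :
    Measurable ((Ioi 0).indicator φ) := by
  classical
  rw [← piecewise_eq_indicator]
  exact ContinuousOn.measurable_piecewise hφ.smooth.continuousOn continuousOn_const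
    measurableSet_Ioi

lemma normLa_eq {a r : ℝ} (hr : 0 < r) (f : ℝ → ℂ) :
    normLa a r f = (∫⁻ x, ‖f x‖ₑ ^ r ∂omega a) ^ (1 / r) := by
  rw [normLa, eLpNorm_eq_lintegral_rpow_enorm_toReal (by simpa using hr) ENNReal.ofReal_ne_top,
    ENNReal.toReal_ofReal hr.le]

/-- As p ≥ 1 and κ ≤ 1, the weight is at most κ⁻¹ ≤ 1 + x. The integrand is then w^p with w = (1 +
x)|φ| bounded and integrable. -/
lemma lintegral_weighted_rpow_lt_top {a p : ℝ} (ha : -1 < a) (hp1 : 1 ≤ p)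
    {κ : ℝ → ℝ} (hκ : ∀ x, 0 < κ x) (hκ1 : ∀ x, 0 < x → κ x ≤ 1)
    (hκ2 : ∀ x, 0 < x → 1 ≤ κ x * (1 + x)) {φ : ℝ → ℂ} (hφ : SchwartzPlus φ) :
    ∫⁻ x, ‖φ x * ((κ x ^ (1 - 2 / p) : ℝ) : ℂ)‖ₑ ^ p ∂omega a < ⊤ := by
  have hp0 : 0 < p := by linarith
  obtain ⟨M, hM, h⟩ := hφ.exists_mul_norm_le
  have hintg := (hφ.integrable ha).const_mul (M ^ (p - 1))
  refine lt_of_le_of_lt (lintegral_mono_ae (ae_omega fun x hx => ?_)) hintg.lintegral_lt_top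
  rw [← ofReal_norm, ENNReal.ofReal_rpow_of_nonneg (norm_nonneg _) hp0.le, norm_mul,
    Complex.norm_real, Real.norm_of_nonneg (rpow_nonneg (hκ x).le _)]
  refine ENNReal.ofReal_le_ofReal ?_
  have hw : κ x ^ (1 - 2 / p) ≤ 1 + |x| := by
    have h1 : κ x ^ (1 - 2 / p) ≤ κ x ^ (-1 : ℝ) := by
      refine rpow_le_rpow_of_exponent_ge (hκ x) (hκ1 x hx) ?_
      have : 2 / p ≤ 2 := by rw [div_le_iff₀ hp0]; linarith
      linarith
    refine h1.trans ?_
    rw [rpow_neg_one, abs_of_pos hx, inv_le_iff_one_le_mul₀ (hκ x), mul_comm]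
    exact hκ2 x hx
  set w := (1 + |x|) * ‖φ x‖ with hwdef
  have hw0 : 0 ≤ w := by positivity
  calc (‖φ x‖ * κ x ^ (1 - 2 / p)) ^ p ≤ w ^ p := by
        refine rpow_le_rpow (mul_nonneg (norm_nonneg _) (rpow_nonneg (hκ x).le _)) ?_ hp0.le
        rw [hwdef, mul_comm]
        gcongr
    _ = w ^ (p - 1) * w := by
        rcases hw0.eq_or_lt with h0 | h0
        · rw [← h0, zero_rpow hp0.ne', mul_zero]
        · rw [← rpow_add_one h0.ne', sub_add_cancel]
    _ ≤ M ^ (p - 1) * w := by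
        gcongr
        exact h x hx

/-- Explains the exponent 1 - 2/s in the theorem: it is what κ^s against the density κ⁻² amounts to.
-/
lemma weight_rpow_eq {κ s : ℝ} (hκ : 0 < κ) (hs : 0 < s) (z : ℂ) :
    (ENNReal.ofReal κ ^ 2)⁻¹ * (ENNReal.ofReal κ * ‖z‖ₑ) ^ s =
      ‖z * ((κ ^ (1 - 2 / s) : ℝ) : ℂ)‖ₑ ^ s := by
  have hn : ‖((κ ^ (1 - 2 / s) : ℝ) : ℂ)‖ₑ = ENNReal.ofReal κ ^ (1 - 2 / s) := by
    rw [← ofReal_norm, Complex.norm_real, Real.norm_of_nonneg (by positivity),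
      ENNReal.ofReal_rpow_of_pos hκ]
  have hk0 : ENNReal.ofReal κ ≠ 0 := by simpa using hκ
  rw [enorm_mul, hn, ENNReal.mul_rpow_of_nonneg _ _ hs.le, ENNReal.mul_rpow_of_nonneg _ _ hs.le,
    ← ENNReal.rpow_mul, show (1 - 2 / s) * s = -2 + s by field_simp; ring,
    ENNReal.rpow_add _ _ hk0 ENNReal.ofReal_ne_top, ENNReal.rpow_neg, ENNReal.rpow_two]
  ring

lemma one_le_conjExponent {r : ℝ} (hr : 2 ≤ r) : 1 ≤ r.conjExponent := by
  rw [Real.conjExponent, le_div_iff₀ (by linarith)]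
  linarith

lemma integrable_kernel_mul {a t : ℝ} (ha : -1 < a) (ht : t ≠ 0) {φ : ℝ → ℂ}
    (hφ : SchwartzPlus φ) {x : ℝ} (hx : 0 < x) :
    Integrable (fun y => kernel a x y t * φ y) (omega a) := by
  obtain ⟨c, χ, hc, hχ, hχ1, H⟩ := exists_kernel_eq a ht
  have hb : 0 < (a + 1) / 2 := by linarith
  have hτ : 0 < 2 * |t| := by have := abs_pos.2 ht; positivity
  have hab : 2 * ((a + 1) / 2) - 1 = a := by ring
  have hf : Measurable fun y => χ y * (Ioi 0).indicator φ y :=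
    hχ.measurable.mul hφ.measurable_indicator
  have h := integrable_hankelKernel_mul hb hτ hf (by
    rw [hab]
    refine (hφ.integrable ha).congr (ae_omega fun y hy => ?_)
    simp only [norm_mul, hχ1, one_mul, indicator_of_mem (mem_Ioi.2 hy)]) x
  rw [hab] at h
  refine (h.const_mul (c * χ x)).congr (ae_omega fun y hy => ?_)
  simp only [indicator_of_mem (mem_Ioi.2 hy), H x y hx hy]
  ring

/-! ### The dispersive estimate from a kernel bound -/

/-- The weighted dispersive estimate, given a pointwise bound on the weighted kernel. -/
theorem exists_weighted_bound {r : ℝ} (hr : 2 ≤ r) :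
    ∃ C : ℝ, 0 < C ∧ ∀ a : ℝ, -1 < a → ∀ κ : ℝ → ℝ, Measurable κ → (∀ x, 0 < κ x) →
      (∀ x, 0 < x → κ x ≤ 1) → (∀ x, 0 < x → 1 ≤ κ x * (1 + x)) → ∀ t : ℝ, t ≠ 0 →
      ∀ B : ℝ, 0 < B →
      (∀ x y, 0 < x → 0 < y → κ x * |hankelKernel ((a + 1) / 2) (2 * |t|) x y| * κ y ≤ B) →
      ∀ φ : ℝ → ℂ, SchwartzPlus φ →
      MemLa a r (fun x => propagator a t φ x * ((κ x ^ (1 - 2 / r) : ℝ) : ℂ)) ∧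
      normLa a r (fun x => propagator a t φ x * ((κ x ^ (1 - 2 / r) : ℝ) : ℂ)) ≤
        ENNReal.ofReal (C * B ^ (1 - 2 / r)) *
          normLa a r.conjExponent (fun x => φ x * ((κ x ^ (1 - 2 / r.conjExponent) : ℝ) : ℂ)) := by
  have hr0 : 0 < r := by linarith
  -- The interpolation constant degenerates at r = 2, where the weight exponent 1 - 2/r vanishes and
  -- the contraction gives constant 1.
  have hC : 0 < if r = 2 then 1 else (4 * r / (r - 2) * 2 ^ (r - 2)) ^ (1 / r) := by
    split_ifs with h
    · exact one_pos
    · have : 0 < r - 2 := by rcases hr.lt_or_eq with h1 | h1 <;> [linarith; exact absurd h1.symm h]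
      positivity
  refine ⟨_, hC, ?_⟩
  intro a ha κ hκm hκ hκ1 hκ2 t ht B hB hbound φ hφ
  obtain ⟨c, χ, hc, hχ, hχ1, H⟩ := exists_kernel_eq a ht
  have hb : 0 < (a + 1) / 2 := by linarith
  have hτ : 0 < 2 * |t| := by have := abs_pos.2 ht; positivity
  have hab : 2 * ((a + 1) / 2) - 1 = a := by ring
  have hp1 := one_le_conjExponent hr
  have hp0 : 0 < r.conjExponent := by linarith
  set f : ℝ → ℂ := fun y => χ y * (Ioi 0).indicator φ y with hfdef
  have hf : Measurable f := hχ.measurable.mul hφ.measurable_indicator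
  have hfe : ∀ y, 0 < y → ‖f y‖ = ‖φ y‖ := fun y hy => by
    simp only [hfdef, norm_mul, hχ1, one_mul, indicator_of_mem (mem_Ioi.2 hy)]
  have hfe' : ∀ y, 0 < y → ‖f y‖ₑ = ‖φ y‖ₑ := fun y hy => by
    rw [← ofReal_norm, hfe y hy, ofReal_norm]
  have hintg : Integrable (fun y => (1 + |y|) * ‖f y‖) (omega a) :=
    (hφ.integrable ha).congr (ae_omega fun y hy => by simp only [hfe y hy])
  set N : ℝ → ℂ := fun x => ∫ y, (hankelKernel ((a + 1) / 2) (2 * |t|) x y : ℂ) * f y ∂omega a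
    with hN
  have hNm : Measurable N := by
    have := measurable_hankel (τ := 2 * |t|) hb hf
    rwa [hab] at this
  have hprop : ∀ x, 0 < x → propagator a t φ x = c * χ x * N x := by
    intro x hx
    simp only [propagator, hN]
    rw [← integral_const_mul]
    refine integral_congr_ae (ae_omega fun y hy => ?_)
    simp only [hfdef, indicator_of_mem (mem_Ioi.2 hy), H x y hx hy]
    ring
  have hpropn : ∀ x, 0 < x → ‖propagator a t φ x‖ₑ = ‖N x‖ₑ := by
    intro x hx
    rw [hprop x hx, ← ofReal_norm, norm_mul, norm_mul, hc, hχ1, one_mul, one_mul, ofReal_norm]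
  have hmeas : AEStronglyMeasurable
      (fun x => propagator a t φ x * ((κ x ^ (1 - 2 / r) : ℝ) : ℂ)) (omega a) := by
    have hm : Measurable fun x => c * χ x * N x * ((κ x ^ (1 - 2 / r) : ℝ) : ℂ) :=
      ((hχ.measurable.const_mul c).mul hNm).mul
        (Complex.measurable_ofReal.comp (hκm.pow_const _))
    exact hm.aestronglyMeasurable.congr (ae_omega fun x hx => by simp only [hprop x hx])
  have hfin := lintegral_weighted_rpow_lt_top ha hp1 hκ hκ1 hκ2 hφ
  have hfinN : normLa a r.conjExponent
      (fun x => φ x * ((κ x ^ (1 - 2 / r.conjExponent) : ℝ) : ℂ)) < ⊤ := by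
    rw [normLa_eq hp0]
    exact ENNReal.rpow_lt_top_of_nonneg (by positivity) hfin.ne
  suffices hle : normLa a r (fun x => propagator a t φ x * ((κ x ^ (1 - 2 / r) : ℝ) : ℂ)) ≤
      ENNReal.ofReal ((if r = 2 then 1 else (4 * r / (r - 2) * 2 ^ (r - 2)) ^ (1 / r)) *
        B ^ (1 - 2 / r)) *
        normLa a r.conjExponent (fun x => φ x * ((κ x ^ (1 - 2 / r.conjExponent) : ℝ) : ℂ)) from
    ⟨⟨hmeas, hle.trans_lt (ENNReal.mul_lt_top ENNReal.ofReal_lt_top hfinN)⟩, hle⟩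
  rcases hr.eq_or_lt with rfl | hr2
  · have hL := lintegral_hankel_sq_le hb hτ hf (by rwa [hab])
    rw [hab] at hL
    have hconj : Real.conjExponent 2 = 2 := by norm_num [Real.conjExponent]
    rw [hconj, normLa_eq two_pos, normLa_eq two_pos]
    norm_num only [if_true, rpow_zero, ENNReal.ofReal_one, one_mul, mul_one, Complex.ofReal_one]
    refine ENNReal.rpow_le_rpow ?_ (by norm_num)
    simp only [ENNReal.rpow_two]
    refine (lintegral_mono_ae (ae_omega fun x hx => (by rw [hpropn x hx]))).trans (hL.trans ?_)
    exact lintegral_mono_ae (ae_omega fun x hx => (by rw [hfe' x hx]))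
  · have hr1 : 0 < r - 1 := by linarith
    have hr2' : 0 < r - 2 := by linarith
    have e1 : ∫⁻ x, (ENNReal.ofReal (κ x) ^ 2)⁻¹ * (ENNReal.ofReal (κ x) * ‖N x‖ₑ) ^ r ∂omega a =
        ∫⁻ x, ‖propagator a t φ x * ((κ x ^ (1 - 2 / r) : ℝ) : ℂ)‖ₑ ^ r ∂omega a :=
      lintegral_congr_ae (ae_omega fun x hx => by
        simp only
        rw [← hpropn x hx, weight_rpow_eq (hκ x) hr0])
    have e2 : ∫⁻ x, (ENNReal.ofReal (κ x) ^ 2)⁻¹ *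
        (ENNReal.ofReal (κ x) * ‖f x‖ₑ) ^ (r / (r - 1)) ∂omega a =
        ∫⁻ x, ‖φ x * ((κ x ^ (1 - 2 / r.conjExponent) : ℝ) : ℂ)‖ₑ ^ r.conjExponent ∂omega a :=
      lintegral_congr_ae (ae_omega fun x hx => by
        simp only
        rw [hfe' x hx]
        exact weight_rpow_eq (hκ x) hp0 _)
    have key := lintegral_weighted_hankel_le hb hτ hκm hκ hB hr2 hbound hf (by rwa [hab])
      (by rw [hab, e2]; exact hfin.ne)
    rw [hab, e2] at key
    rw [e1] at key
    rw [normLa_eq hr0, normLa_eq hp0, if_neg hr2.ne']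
    refine (ENNReal.rpow_le_rpow key (by positivity : 0 ≤ 1 / r)).trans (le_of_eq ?_)
    rw [ENNReal.mul_rpow_of_nonneg _ _ (by positivity), ENNReal.ofReal_rpow_of_pos (by positivity),
      ← ENNReal.rpow_mul, show (r - 1) * (1 / r) = 1 / r.conjExponent by
        rw [Real.conjExponent]; field_simp]
    congr 2
    rw [mul_rpow two_pos.le hB.le, ← mul_assoc, mul_rpow (by positivity) (by positivity),
      ← rpow_mul hB.le, show (r - 2) * (1 / r) = 1 - 2 / r by field_simp]

/-! ### Pointwise kernel bounds -/

lemma abs_hankelKernel_le {b T : ℝ} (hb : 1 / 2 ≤ b) (hT : 0 < T) (x y : ℝ) :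
    |hankelKernel b (2 * T) x y| ≤ 2 ^ (1 - b) * 2 ^ (-b) * (Gamma b)⁻¹ * T ^ (-b) := by
  rw [hankelKernel, abs_mul, abs_of_pos (by positivity), mul_rpow two_pos.le hT.le]
  have h := abs_hyp_neg_le hb (sq_nonneg (x * y / (2 * (2 * T))))
  calc 2 ^ (1 - b) * (2 ^ (-b) * T ^ (-b)) * |hyp b (-(x * y / (2 * (2 * T))) ^ 2)|
      ≤ 2 ^ (1 - b) * (2 ^ (-b) * T ^ (-b)) * (Gamma b)⁻¹ := by gcongr
    _ = _ := by ring

lemma k₁_pos (a : ℝ) {x : ℝ} (hx : 0 < x) : 0 < k₁ a x := lt_min one_pos (rpow_pos_of_pos hx _)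

lemma k₁_le_one (a x : ℝ) : k₁ a x ≤ 1 := min_le_left _ _

lemma k₁_mul_rpow_le_one (a : ℝ) {x : ℝ} (hx : 0 < x) : k₁ a x * x ^ (-(a / 2)) ≤ 1 := by
  rw [rpow_neg hx.le, ← div_eq_mul_inv, div_le_one (rpow_pos_of_pos hx _)]
  exact min_le_right _ _

lemma one_le_k₁_mul {a : ℝ} (ha : -1 < a) (ha0 : a < 0) {x : ℝ} (hx : 0 < x) :
    1 ≤ k₁ a x * (1 + x) := by
  rw [k₁, min_mul_of_nonneg _ _ (by linarith)]
  refine le_min (by linarith) ?_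
  have h1 : x ^ (-(a / 2)) ≤ 1 + x := by
    refine (rpow_le_rpow hx.le (by linarith : x ≤ 1 + x) (by linarith)).trans ?_
    exact (rpow_le_rpow_of_exponent_le (by linarith) (by linarith : -(a / 2) ≤ 1)).trans
      (by rw [rpow_one])
  rw [rpow_neg hx.le, inv_le_iff_one_le_mul₀ (rpow_pos_of_pos hx _), mul_comm] at h1
  exact h1

/-- The growth exponent gives s^(-a/2) with s = xy/(4T), a product of powers of x, y and T. Both
k₁(x) and k₁(x) x^(-a/2) are at most 1, and T^(-b) T^(a/2) = T^(-1/2). -/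
lemma exists_k₁_mul_hankelKernel_le {a : ℝ} (ha : -1 < a) (ha0 : a < 0) :
    ∃ D, 0 < D ∧ ∀ T, 0 < T → ∀ x y, 0 < x → 0 < y →
      k₁ a x * |hankelKernel ((a + 1) / 2) (2 * T) x y| * k₁ a y ≤
        D * (T ^ (-((a + 1) / 2)) + T ^ (-(1 / 2) : ℝ)) := by
  obtain ⟨C, hC, h⟩ := exists_abs_hyp_neg_le (b := (a + 1) / 2) (by linarith) (by linarith)
  refine ⟨2 ^ (1 - (a + 1) / 2) * 2 ^ (-((a + 1) / 2)) * C, by positivity,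
    fun T hT x y hx hy => ?_⟩
  set b := (a + 1) / 2 with hb
  set s := x * y / (2 * (2 * T)) with hs
  have hs0 : 0 < s := by positivity
  -- An inequality only because the factor 4^(a/2) ≤ 1 is discarded.
  have hsp : (s ^ 2) ^ ((1 / 2 - b) / 2) ≤ x ^ (-(a / 2)) * y ^ (-(a / 2)) * T ^ (a / 2) := by
    rw [← rpow_natCast s 2, ← rpow_mul hs0.le,
      show ((2 : ℕ) : ℝ) * ((1 / 2 - b) / 2) = -(a / 2) by rw [hb]; push_cast; ring, hs,
      div_rpow (by positivity) (by positivity), mul_rpow hx.le hy.le,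
      rpow_neg (by positivity : 0 ≤ 2 * (2 * T)), div_inv_eq_mul]
    gcongr ?_ * ?_
    refine rpow_le_rpow_of_nonpos hT (by linarith) (by linarith)
  have hTb : T ^ (-b) * T ^ (a / 2) = T ^ (-(1 / 2) : ℝ) := by
    rw [← rpow_add hT, hb]; congr 1; ring
  have hx0 := k₁_pos a hx
  have hy0 := k₁_pos a hy
  have hxy1 : k₁ a x * k₁ a y ≤ 1 := mul_le_one₀ (k₁_le_one a x) hy0.le (k₁_le_one a y)
  have hxy2 : k₁ a x * x ^ (-(a / 2)) * (k₁ a y * y ^ (-(a / 2))) ≤ 1 :=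
    mul_le_one₀ (k₁_mul_rpow_le_one a hx) (by positivity) (k₁_mul_rpow_le_one a hy)
  have hTa : 0 < T ^ (a / 2) := by positivity
  rw [hankelKernel, ← hs, abs_mul, abs_of_pos (by positivity), mul_rpow two_pos.le hT.le]
  calc k₁ a x * (2 ^ (1 - b) * (2 ^ (-b) * T ^ (-b)) * |hyp b (-s ^ 2)|) * k₁ a y
      ≤ k₁ a x * (2 ^ (1 - b) * (2 ^ (-b) * T ^ (-b)) *
          (C * (1 + x ^ (-(a / 2)) * y ^ (-(a / 2)) * T ^ (a / 2)))) * k₁ a y := by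
        gcongr
        refine (h _ (sq_nonneg s)).trans ?_
        gcongr
    _ = 2 ^ (1 - b) * 2 ^ (-b) * C * T ^ (-b) * (k₁ a x * k₁ a y +
          k₁ a x * x ^ (-(a / 2)) * (k₁ a y * y ^ (-(a / 2))) * T ^ (a / 2)) := by ring
    _ ≤ 2 ^ (1 - b) * 2 ^ (-b) * C * T ^ (-b) * (1 + 1 * T ^ (a / 2)) := by gcongr
    _ = _ := by rw [one_mul, mul_add, mul_add, ← hTb]; ring

end BesselSchrodinger

end

/-! ### The two dispersive estimates -/

open BesselSchrodinger in
theorem proposition3p4 (r : ℝ) (hr : 2 ≤ r) :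
    (∀ a : ℝ, 0 ≤ a → ∃ C : ℝ, 0 < C ∧ ∀ φ : ℝ → ℂ, SchwartzPlus φ → ∀ t : ℝ, t ≠ 0 →
      (∀ x : ℝ, 0 < x → Integrable (fun y => kernel a x y t * φ y) (omega a)) ∧
      MemLa a r (propagator a t φ) ∧
      normLa a r (propagator a t φ) ≤
        ENNReal.ofReal (C * |t| ^ (-((a + 1) * (1 / 2 - 1 / r)))) *
          normLa a r.conjExponent φ) ∧
    (∀ a : ℝ, -1 < a → a < 0 → ∃ C : ℝ, 0 < C ∧ ∀ φ : ℝ → ℂ, SchwartzPlus φ → ∀ t : ℝ, t ≠ 0 →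
      (∀ x : ℝ, 0 < x → Integrable (fun y => kernel a x y t * φ y) (omega a)) ∧
      MemLa a r (weighted a (1 - 2 / r) (propagator a t φ)) ∧
      normLa a r (weighted a (1 - 2 / r) (propagator a t φ)) ≤
        ENNReal.ofReal
            (C * (|t| ^ (-((a + 1) * (1 / 2 - 1 / r))) + |t| ^ (-(1 / 2 - 1 / r)))) *
          normLa a r.conjExponent (weighted a (1 - 2 / r.conjExponent) φ)) := by
  obtain ⟨C, hC, H⟩ := exists_weighted_bound hr
  refine ⟨fun a ha => ?_, fun a ha ha0 => ?_⟩
  · have hG : 0 < (Real.Gamma ((a + 1) / 2))⁻¹ := inv_pos.2 (Real.Gamma_pos_of_pos (by linarith))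
    set D : ℝ := 2 ^ (1 - (a + 1) / 2) * 2 ^ (-((a + 1) / 2)) * (Real.Gamma ((a + 1) / 2))⁻¹
      with hD
    have hD0 : 0 < D := by positivity
    refine ⟨C * D ^ (1 - 2 / r), by positivity, fun φ hφ t ht =>
      ⟨fun x hx => integrable_kernel_mul (by linarith) ht hφ hx, ?_⟩⟩
    have ht0 : 0 < |t| := abs_pos.2 ht
    have h := H a (by linarith) (fun _ => 1) measurable_const (fun _ => one_pos)
      (fun _ _ => le_rfl) (fun x hx => by linarith) t ht (D * |t| ^ (-((a + 1) / 2)))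
      (by positivity) (fun x y _ _ => by
        rw [one_mul, mul_one]; exact abs_hankelKernel_le (by linarith) ht0 x y) φ hφ
    simp only [Real.one_rpow, Complex.ofReal_one, mul_one] at h
    rwa [Real.mul_rpow hD0.le (by positivity), ← Real.rpow_mul ht0.le, ← mul_assoc,
      show -((a + 1) / 2) * (1 - 2 / r) = -((a + 1) * (1 / 2 - 1 / r)) by ring] at h
  · obtain ⟨D, hD, hbound⟩ := exists_k₁_mul_hankelKernel_le ha ha0
    refine ⟨C * D ^ (1 - 2 / r), by positivity, fun φ hφ t ht =>
      ⟨fun x hx => integrable_kernel_mul ha ht hφ hx, ?_⟩⟩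
    have ht0 : 0 < |t| := abs_pos.2 ht
    classical
    -- `exists_weighted_bound` requires a weight positive on all of ℝ, whereas `k₁ a 0 = 0` because
    -- zero to a nonzero power is 0; `omega a` does not see the change off (0, ∞).
    set κ : ℝ → ℝ := (Ioi (0 : ℝ)).piecewise (k₁ a) (fun _ => 1) with hκ
    have hκe : ∀ x, 0 < x → κ x = k₁ a x := fun x hx => piecewise_eq_of_mem _ _ _ hx
    have hk₁m : Measurable (k₁ a) := measurable_const.min (measurable_id.pow_const _)
    have hcongr : ∀ (s : ℝ) (f : ℝ → ℂ),
        (fun x => f x * ((κ x ^ s : ℝ) : ℂ)) =ᵐ[omega a] weighted a s f := fun s f =>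
      ae_omega fun x hx => by simp only [weighted, hκe x hx]
    have h := H a ha κ (Measurable.piecewise measurableSet_Ioi hk₁m measurable_const)
      (fun x => by
        by_cases hx : 0 < x
        · rw [hκe x hx]; exact k₁_pos a hx
        · rw [hκ, piecewise_eq_of_notMem _ _ _ (by simpa using hx)]; exact one_pos)
      (fun x hx => by rw [hκe x hx]; exact k₁_le_one a x)
      (fun x hx => by rw [hκe x hx]; exact one_le_k₁_mul ha ha0 hx) t ht
      (D * (|t| ^ (-((a + 1) / 2)) + |t| ^ (-(1 / 2) : ℝ))) (by positivity)
      (fun x y hx hy => by rw [hκe x hx, hκe y hy]; exact hbound _ ht0 x y hx hy) φ hφ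
    simp only [MemLa, normLa, memLp_congr_ae (hcongr _ _), eLpNorm_congr_ae (hcongr _ _)] at h
    refine ⟨h.1, h.2.trans ?_⟩
    simp only [normLa]
    gcongr ENNReal.ofReal ?_ * _
    have hr0 : 2 / r ≤ 1 := by rw [div_le_one (by linarith)]; exact hr
    have hr1 : 0 < 2 / r := by positivity
    rw [Real.mul_rpow hD.le (by positivity), ← mul_assoc,
      show -((a + 1) * (1 / 2 - 1 / r)) = -((a + 1) / 2) * (1 - 2 / r) by ring,
      show -(1 / 2 - 1 / r) = -(1 / 2) * (1 - 2 / r) by ring, Real.rpow_mul ht0.le,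
      Real.rpow_mul ht0.le]
    gcongr
    -- Subadditivity of u ↦ u^θ for θ = 1 - 2/r in [0, 1] splits the kernel bound into the two
    -- powers of |t|.
    exact Real.rpow_add_le_add_rpow (by positivity) (by positivity) (by linarith) (by linarith)
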